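/- For a lattice $\Lambda\subset\mathbb R^2$ and a convex set $\Omega\subset\mathbb R^2$ put $c_\lambda^\Omega=-\inf_{q\in\Omega}\lambda\cdot q$ and let $\mathcal F_\Lambda^\Omega(p)=\inf_{\lambda\in\Lambda\setminus\{0\}}(c_\lambda^\Omega+\lambda\cdot p)$ be the tropical distance function; the monomial $c_\lambda^\Omega+\lambda\cdot p$ has gradient $\lambda$. The space of lattices of co-area one is the homogeneous space $\{g\mathbb Z^2\}$ of $\operatorname{SL}_2(\mathbb R)$ modulo $\operatorname{SL}_2(\mathbb Z)$; let $\mu$ be its invariant measure, normalized to have total volume $\zeta(2)=\pi^2/6$. For $h>0$ let $$\mathcal A_h^\Omega(p)=\frac{6}{\pi^2}\Big(\int \mathcal F_\Lambda^\Omega(p)^h\,d\mu[\Lambda]\Big)^{1/h}.$$ Let $\bigcirc$ be the unit disk, and let $U=\{z\in\mathbb H: |\operatorname{Re} z|<\tfrac12,\ |z|>1\}$ be the interior of the standard fundamental domain of $\operatorname{SL}_2(\mathbb Z)$ in the upper half-plane $\mathbb H$ with hyperbolic measure $dx\,dy/y^2$. 1. Let $a,c>0$ and $b$ be real with $4ac-b^2=4$,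 let $E=\{ax^2+bxy+cy^2\le 1\}$, and let $z\in\mathbb H$ be the root of $az^2+bz+c=0$ with positive imaginary part. Then $z\in U$ if and only if both of the following hold: (i) the gradients of the monomials of $\mathcal F_{\mathbb Z^2}^{E}$ that contribute to its maximum (that is, attain the infimum at some point of $E$ where $\mathcal F_{\mathbb Z^2}^{E}$ is maximal) are exactly $(\pm1,0)$ and $(0,\pm1)$; (ii) the monomials that attain the infimum at the center $(0,0)$ are exactly those with gradients $(0,\pm1)$. If $z\in U$, then $\mathcal F_{\mathbb Z^2}^{E}(0,0)=\sqrt a$ (and $a=1/\operatorname{Im}z$). 2. $$\mathcal A_1^{\bigcirc}(0,0)=(\operatorname{Area}U)^{-1}\int_U(\operatorname{Im}z)^{-1/2}\,\frac{d\operatorname{Re}z\,d\operatorname{Im}z}{(\operatorname{Im}z)^2}=\frac4\pi\int_0^{\pi/6}\frac{dt}{\sqrt{\cos t}}\approx0.682\ldots,$$ where the last relation means that the value lies strictly between $0.682$ and $0.683$. -/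

import Mathlib

open MeasureTheory
open scoped ENNReal MatrixGroups UpperHalfPlane

namespace EquiAffine

/-- The plane `ℝ²` with its dot product. -/
abbrev Plane : Type := EuclideanSpace ℝ (Fin 2)

/-! ### Tropical structures of co-area one -/

/-- The standard tropical structure `ℤ² ⊂ ℝ²`. -/
def stdLattice : AddSubgroup Plane where
  carrier := {v | ∀ i, ∃ n : ℤ, v i = n}
  zero_mem' := fun _ => ⟨0, by simp⟩
  add_mem' := by
    intro v w hv hw i
    obtain ⟨m, hm⟩ := hv i
    obtain ⟨n, hn⟩ := hw i
    exact ⟨m + n, by simp [hm, hn]⟩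
  neg_mem' := by
    intro v hv i
    obtain ⟨m, hm⟩ := hv i
    exact ⟨-m, by simp [hm]⟩

/-- The linear map of the plane given by an element of `SL₂(ℝ)`. -/
noncomputable def act (g : SL(2, ℝ)) : Plane →ₗ[ℝ] Plane :=
  Matrix.toEuclideanLin (g : Matrix (Fin 2) (Fin 2) ℝ)

/-- The lattice `g ℤ²`, of co-area one. -/
noncomputable def latticeOf (g : SL(2, ℝ)) : AddSubgroup Plane :=
  stdLattice.map (act g).toAddMonoidHom

/-- `SL₂(ℤ)` as a subgroup of `SL₂(ℝ)`. -/
def integralSL : Subgroup SL(2, ℝ) :=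
  (Matrix.SpecialLinearGroup.map (n := Fin 2) (Int.castRingHom ℝ)).range

theorem act_mul (g h : SL(2, ℝ)) (v : Plane) : act (g * h) v = act g (act h v) := by
  ext i
  simp [act, Matrix.toLpLin_apply]

theorem act_integral_mem {g : SL(2, ℝ)} (hg : g ∈ integralSL) {v : Plane}
    (hv : v ∈ stdLattice) : act g v ∈ stdLattice := by
  obtain ⟨s, rfl⟩ := hg
  intro i
  choose n hn using hv
  refine ⟨(s : Matrix (Fin 2) (Fin 2) ℤ).mulVec n i, ?_⟩
  fin_cases i <;>
    simp [act, Matrix.toLpLin_apply, Matrix.mulVec, dotProduct, Fin.sum_univ_two, hn]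

theorem latticeOf_mul_le (g : SL(2, ℝ)) {s : SL(2, ℝ)} (hs : s ∈ integralSL) :
    latticeOf (g * s) ≤ latticeOf g := by
  rintro _ ⟨v, hv, rfl⟩
  exact ⟨act s v, act_integral_mem hs hv, (act_mul g s v).symm⟩

/-- The space of tropical structures of co-area one: the group `SL₂(ℝ)` acts transitively on
these lattices, and the stabilizer of `ℤ²` is `SL₂(ℤ)`. -/
abbrev TropStr : Type := SL(2, ℝ) ⧸ integralSL

/-- The lattice `g ℤ²` corresponding to the class of `g`. -/
noncomputable def TropStr.lattice (x : TropStr) : AddSubgroup Plane :=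
  Quotient.liftOn' x latticeOf (by
    intro g h hgh
    have hs : g⁻¹ * h ∈ integralSL := QuotientGroup.leftRel_apply.mp hgh
    apply le_antisymm
    · have := latticeOf_mul_le h (integralSL.inv_mem hs)
      simpa using this
    · have := latticeOf_mul_le g hs
      simpa using this)

/-! ### The invariant measure -/

noncomputable instance : MeasurableSpace SL(2, ℝ) := borel _

instance : BorelSpace SL(2, ℝ) := ⟨rfl⟩

instance : LocallyCompactSpace SL(2, ℝ) :=
  have : LocallyCompactSpace (Matrix (Fin 2) (Fin 2) ℝ) :=
    inferInstanceAs (LocallyCompactSpace (Fin 2 → Fin 2 → ℝ))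
  Matrix.SpecialLinearGroup.isClosedEmbedding_val.locallyCompactSpace

/-- The measure on the quotient induced by Haar measure on `SL₂(ℝ)`: the least measure that
dominates the image of Haar measure restricted to any measurable set which meets each coset at
most once (the supremum is attained at a strict fundamental domain). -/
noncomputable def quotientHaar : Measure TropStr :=
  ⨆ (E : Set SL(2, ℝ)) (_ : MeasurableSet E)
    (_ : Set.InjOn (fun g => (QuotientGroup.mk g : TropStr)) E),
    (Measure.haar.restrict E).map (fun g => (QuotientGroup.mk g : TropStr))

/-- The invariant measure `μ` on the space of tropical structures of co-area one, normalized to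
have total volume `ζ(2) = π² / 6`. -/
noncomputable def tropMeasure : Measure TropStr :=
  (ENNReal.ofReal (Real.pi ^ 2 / 6) / quotientHaar Set.univ) • quotientHaar

/-! ### Tropical and equi-affine distance functions -/

/-- The coefficient `c_l = - inf_{q ∈ Ω} l · q`. -/
noncomputable def coeff (Ω : Set Plane) (l : Plane) : EReal :=
  - ⨅ q ∈ Ω, ((inner ℝ l q : ℝ) : EReal)

/-- The tropical monomial `c_l + l · p`. -/
noncomputable def monomialAt (Ω : Set Plane) (l p : Plane) : EReal :=
  coeff Ω l + ((inner ℝ l p : ℝ) : EReal)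

/-- The tropical distance function `F_Λ^Ω(p) = inf_{l ∈ Λ \ {0}} (c_l + l · p)`. -/
noncomputable def tropDist (L : AddSubgroup Plane) (Ω : Set Plane) (p : Plane) : EReal :=
  ⨅ l ∈ {l : Plane | l ∈ L ∧ l ≠ 0}, monomialAt Ω l p

/-- The gradients of the monomials that attain the infimum at `p`. -/
def minimizers (L : AddSubgroup Plane) (Ω : Set Plane) (p : Plane) : Set Plane :=
  {l | l ∈ L ∧ l ≠ 0 ∧ monomialAt Ω l p = tropDist L Ω p}

/-- The gradients of the monomials contributing to the maximum: those that attain the infimum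
at some point of `Ω` where the tropical distance function is maximal. -/
def maxGradients (L : AddSubgroup Plane) (Ω : Set Plane) : Set Plane :=
  {l | ∃ p ∈ Ω, IsMaxOn (tropDist L Ω) Ω p ∧ l ∈ minimizers L Ω p}

/-- The `h`-equi-affine distance function. -/
noncomputable def equiAffineDist (h : ℝ) (Ω : Set Plane) (p : Plane) : ℝ≥0∞ :=
  ENNReal.ofReal (6 / Real.pi ^ 2) *
    (∫⁻ x : TropStr, (tropDist x.lattice Ω p).toENNReal ^ h ∂tropMeasure) ^ h⁻¹

/-! ### The disk, the ellipses, the fundamental domain -/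

/-- The unit disk. -/
def disk : Set Plane := Metric.closedBall 0 1

/-- The domain bounded by the ellipse `a x² + b x y + c y² = 1`. -/
def ellipse (a b c : ℝ) : Set Plane :=
  {p | a * p 0 ^ 2 + b * (p 0 * p 1) + c * p 1 ^ 2 ≤ 1}

/-- The interior of the standard fundamental domain of `SL₂(ℤ)` in the upper half-plane. -/
def domainU : Set ℍ := {z | |z.re| < 1 / 2 ∧ 1 < ‖(z : ℂ)‖}

end EquiAffine

open EquiAffine

namespace EquiAffine

/-! ### Unimodularity of `SL₂(ℝ)` -/

/-! For the ellipses, the coefficient of a monomial with gradient `(m, n)` is the square root of the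
dual form `N = c m² - b m n + a n²`, which has determinant one (`coeff_ellipse`). The condition on
`z` says that the form is strictly reduced, `|b| < a < c` (`mem_domainU_iff`). The gradients `(0,
±1)` bound the distance by `√a - |p 1|`, so the maximum `√a` is attained on the horizontal segment
`|p 0| ≤ √c - √a` through the center, whose ends are cut off by `(±1, 0)`. By `lt_sqrt_dualForm` no
other monomial touches this segment. Conversely, the minimizers at the center force `a < c`, and the
absence of `(1, ±1)` among the gradients at the maximum forces `|b| < a` (`reduced_of_gradients`).

For the average, the distance at the center of the disk is the length of a shortest lattice vector,
which depends on `g` only through `shape g = g⁻¹ • I`. Since `SL₂(ℝ)` is unimodular, `shape` carries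
Haar measure to a multiple of hyperbolic measure (`exists_map_shape_haar`), and half of the preimage
of `domainU` is a fundamental domain for `SL₂(ℤ)` up to a null set (`quotientHaar_eq_map`). The
unknown Haar constant cancels against the normalization. Over `domainU` the shortest length is `(Im
z)^(-1/2)`; integrating in the vertical direction and substituting `x = sin t` gives the cosine
integral, which quartic bounds on the integrand enclose. -/

instance : SecondCountableTopology SL(2, ℝ) :=
  have : SecondCountableTopology (Matrix (Fin 2) (Fin 2) ℝ) :=
    inferInstanceAs (SecondCountableTopology (Fin 2 → Fin 2 → ℝ))
  Matrix.SpecialLinearGroup.isClosedEmbedding_val.isEmbedding.secondCountableTopology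

instance : Countable SL(2, ℤ) :=
  have : Countable (Matrix (Fin 2) (Fin 2) ℤ) := inferInstanceAs (Countable (Fin 2 → Fin 2 → ℤ))
  inferInstanceAs (Countable (Subtype _))

/-- The upper unipotent elements of `SL₂(ℝ)`. -/
def upperUnipotent (t : ℝ) : SL(2, ℝ) := ⟨!![1, t; 0, 1], by simp⟩

/-- The lower unipotent elements of `SL₂(ℝ)`. -/
def lowerUnipotent (t : ℝ) : SL(2, ℝ) := ⟨!![1, 0; t, 1], by simp⟩

@[simp]
theorem coe_upperUnipotent (t : ℝ) :
    (upperUnipotent t : Matrix (Fin 2) (Fin 2) ℝ) = !![1, t; 0, 1] := rfl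

@[simp]
theorem coe_lowerUnipotent (t : ℝ) :
    (lowerUnipotent t : Matrix (Fin 2) (Fin 2) ℝ) = !![1, 0; t, 1] := rfl

/-- Conjugation by `diag(2, 1/2)` multiplies the unipotent parameter by `4`. In a commutative target
the two sides have equal images, and cancelling the common factor kills the image of `upperUnipotent
(3 * t)`. -/
theorem semiconjBy_upperUnipotent (t : ℝ) :
    ∃ g : SL(2, ℝ), SemiconjBy g (upperUnipotent t) (upperUnipotent (3 * t) * upperUnipotent t) := by
  obtain ⟨g, hg⟩ : ∃ g : SL(2, ℝ), (g : Matrix (Fin 2) (Fin 2) ℝ) = !![2, 0; 0, 2⁻¹] :=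
    ⟨⟨!![2, 0; 0, 2⁻¹], by simp⟩, rfl⟩
  refine ⟨g, ?_⟩
  ext i j
  fin_cases i <;> fin_cases j <;> simp [hg] <;> ring

theorem semiconjBy_lowerUnipotent (t : ℝ) :
    ∃ g : SL(2, ℝ), SemiconjBy g (upperUnipotent (-t)) (lowerUnipotent t) := by
  obtain ⟨g, hg⟩ : ∃ g : SL(2, ℝ), (g : Matrix (Fin 2) (Fin 2) ℝ) = !![0, -1; 1, 0] :=
    ⟨⟨!![0, -1; 1, 0], by simp⟩, rfl⟩
  refine ⟨g, ?_⟩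
  ext i j
  fin_cases i <;> fin_cases j <;> simp [hg]

theorem eq_unipotent_mul {g : SL(2, ℝ)} (hg : g 1 0 ≠ 0) :
    g = upperUnipotent ((g 0 0 - 1) / g 1 0) * lowerUnipotent (g 1 0) *
      upperUnipotent ((g 1 1 - 1) / g 1 0) := by
  have hdet := g.det_coe
  rw [Matrix.det_fin_two] at hdet
  ext i j
  fin_cases i <;> fin_cases j <;> simp <;> field_simp
  · ring
  · linear_combination -hdet
  · ring

theorem map_eq_of_semiconjBy {G M : Type*} [Group G] [CommMonoid M] (f : G →* M) {g x y : G}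
    (h : SemiconjBy g x y) : f x = f y := by
  have h' : f g * f x = f y * f g := by rw [← map_mul, ← map_mul, h.eq]
  rw [mul_comm] at h'
  exact ((Group.isUnit g).map f).mul_right_cancel h'

/-- Unipotent elements generate the group and die in every commutative quotient. Applied to the
modular character, this yields unimodularity. -/
theorem specialLinearGroup_monoidHom_eq_one {M : Type*} [CommMonoid M] (f : SL(2, ℝ) →* M)
    (g : SL(2, ℝ)) : f g = 1 := by
  have hU : ∀ t, f (upperUnipotent t) = 1 := by
    intro t
    obtain ⟨g, hg⟩ := semiconjBy_upperUnipotent (t / 3)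
    have h := map_eq_of_semiconjBy f hg
    rw [mul_div_cancel₀ _ three_ne_zero, map_mul] at h
    have hunit : IsUnit (f (upperUnipotent (t / 3))) := (Group.isUnit _).map f
    exact hunit.mul_right_cancel (by rw [← h, one_mul])
  have hL : ∀ t, f (lowerUnipotent t) = 1 := by
    intro t
    obtain ⟨g, hg⟩ := semiconjBy_lowerUnipotent t
    rw [← map_eq_of_semiconjBy f hg, hU]
  have key : ∀ g : SL(2, ℝ), g 1 0 ≠ 0 → f g = 1 := by
    intro g hg
    rw [eq_unipotent_mul hg, map_mul, map_mul, hU, hU, hL, one_mul, one_mul]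
  by_cases hg : g 1 0 = 0
  -- Adding the first row to the second moves `g 0 0` into the lower left corner, where it is
  -- nonzero because the determinant is one.
  · have h1 : f (lowerUnipotent 1 * g) = 1 := by
      apply key
      have hdet := g.det_coe
      rw [Matrix.det_fin_two, hg] at hdet
      have h0 : g 0 0 ≠ 0 := by
        rintro h
        simp [h] at hdet
      simpa [hg, Matrix.mul_apply, Fin.sum_univ_two] using h0
    rwa [map_mul, hL, one_mul] at h1
  · exact key g hg

instance : (Measure.haar : Measure SL(2, ℝ)).IsMulRightInvariant where
  map_mul_right_eq_self g := by
    have h : Measure.modularCharacterFun g = 1 :=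
      specialLinearGroup_monoidHom_eq_one Measure.modularCharacter g
    rw [Measure.map_right_mul_eq_modularCharacterFun_smul, h, one_smul]

open UpperHalfPlane

instance : SMulInvariantMeasure SL(2, ℝ) ℍ volume where
  measure_preimage_smul g _ hs :=
    measure_preimage_smul_of_nullMeasurableSet hs.nullMeasurableSet
      (Matrix.SpecialLinearGroup.mapGL ℝ g : GL (Fin 2) ℝ)

/-- The left `SO₂`-invariant projection `g ↦ g⁻¹ • i` onto the upper half-plane. -/
noncomputable def shape (g : SL(2, ℝ)) : ℍ := g⁻¹ • I

theorem shape_mul (g h : SL(2, ℝ)) : shape (g * h) = h⁻¹ • shape g := by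
  simp [shape, mul_smul]

theorem continuous_shape : Continuous shape := by
  unfold shape
  fun_prop

/-! ### The image of Haar measure on the upper half-plane -/

instance : (volume : Measure ℍ).IsOpenPosMeasure where
  open_pos U hU hne := by
    rw [volume_eq_lintegral]
    have hU' : IsOpen ((↑) '' U : Set ℂ) := isOpenEmbedding_coe.isOpenMap U hU
    refine (setLIntegral_pos_iff (by fun_prop)).2 ?_ |>.ne'
    refine lt_of_lt_of_le (hU'.measure_pos volume (hne.image _)) (measure_mono ?_)
    rintro _ ⟨z, hz, rfl⟩
    refine ⟨?_, z, hz, rfl⟩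
    simp [z.im_ne_zero]

/-- By transitivity a change of base point is a left translation of `g`. The companion
`haar_preimage_orbit_smul` translates on the right, and this is where unimodularity enters. -/
theorem haar_preimage_shape_smul (B : Set ℍ) (z : ℍ) :
    Measure.haar {g : SL(2, ℝ) | g⁻¹ • z ∈ B} = Measure.haar (shape ⁻¹' B) := by
  obtain ⟨h, rfl⟩ := MulAction.exists_smul_eq SL(2, ℝ) I z
  rw [← measure_preimage_mul Measure.haar h⁻¹ (shape ⁻¹' B)]
  congr 1
  ext g
  simp [shape, mul_smul]

theorem haar_preimage_orbit_smul (C : Set ℍ) (z : ℍ) :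
    Measure.haar {g : SL(2, ℝ) | g • z ∈ C} = Measure.haar {g : SL(2, ℝ) | g • I ∈ C} := by
  obtain ⟨h, rfl⟩ := MulAction.exists_smul_eq SL(2, ℝ) I z
  rw [← measure_preimage_mul_right Measure.haar h {g : SL(2, ℝ) | g • I ∈ C}]
  congr 1
  ext g
  simp [mul_smul]

/-- Double counting of pairs `(z, g)` with `z ∈ C` and `g⁻¹ • z ∈ B`. Slicing by `z` gives the left
side; for fixed `g` the volume-preserving map `z ↦ g • z` turns the slices into those of the right
side. -/
theorem haar_shape_mul_volume {B C : Set ℍ} (hB : MeasurableSet B) (hC : MeasurableSet C) :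
    Measure.haar (shape ⁻¹' B) * volume C =
      Measure.haar {g : SL(2, ℝ) | g • I ∈ C} * volume B := by
  have h1 : MeasurableSet {p : ℍ × SL(2, ℝ) | p.1 ∈ C ∧ p.2⁻¹ • p.1 ∈ B} :=
    (measurable_fst hC).inter
      ((by fun_prop : Continuous fun p : ℍ × SL(2, ℝ) => p.2⁻¹ • p.1).measurable hB)
  have h2 : MeasurableSet {p : ℍ × SL(2, ℝ) | p.1 ∈ B ∧ p.2 • p.1 ∈ C} :=
    (measurable_fst hB).inter
      ((by fun_prop : Continuous fun p : ℍ × SL(2, ℝ) => p.2 • p.1).measurable hC)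
  have e1 : ((volume : Measure ℍ).prod Measure.haar) _ = _ := Measure.prod_apply h1
  have e2 : ((volume : Measure ℍ).prod Measure.haar) _ = _ := Measure.prod_apply h2
  have slice1 : ∀ z : ℍ, Measure.haar (Prod.mk z ⁻¹'
      {p : ℍ × SL(2, ℝ) | p.1 ∈ C ∧ p.2⁻¹ • p.1 ∈ B}) =
        C.indicator (fun _ => Measure.haar (shape ⁻¹' B)) z := by
    intro z
    by_cases hz : z ∈ C
    · rw [Set.indicator_of_mem hz, ← haar_preimage_shape_smul B z]
      simp [Set.preimage, hz]
    · simp [Set.preimage, hz]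
  have slice2 : ∀ z : ℍ, Measure.haar (Prod.mk z ⁻¹'
      {p : ℍ × SL(2, ℝ) | p.1 ∈ B ∧ p.2 • p.1 ∈ C}) =
        B.indicator (fun _ => Measure.haar {g : SL(2, ℝ) | g • I ∈ C}) z := by
    intro z
    by_cases hz : z ∈ B
    · rw [Set.indicator_of_mem hz, ← haar_preimage_orbit_smul C z]
      simp [Set.preimage, hz]
    · simp [Set.preimage, hz]
  simp_rw [slice1] at e1
  simp_rw [slice2] at e2
  rw [lintegral_indicator_const hC] at e1
  rw [lintegral_indicator_const hB] at e2
  rw [← e1, ← e2, Measure.prod_apply_symm h1, Measure.prod_apply_symm h2]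
  refine lintegral_congr fun g => ?_
  rw [← measure_preimage_smul volume g]
  congr 1
  ext z
  simp [and_comm]

theorem exists_map_shape_haar : ∃ c : ℝ≥0∞, c ≠ 0 ∧ c ≠ ∞ ∧
    (Measure.haar : Measure SL(2, ℝ)).map shape = c • volume := by
  -- Any compact neighbourhood of `I` would do as test set: properness of the orbit map makes the
  -- constant finite, and openness of the ball makes it positive.
  set C : Set ℍ := Metric.closedBall I 1
  have hC0 : volume C ≠ 0 := (Metric.measure_closedBall_pos volume I one_pos).ne'
  have hCc : IsCompact C := isCompact_closedBall I 1
  have hCt : volume C ≠ ∞ := hCc.measure_lt_top.ne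
  have hcont : Continuous fun g : SL(2, ℝ) => g • I := by fun_prop
  refine ⟨Measure.haar {g : SL(2, ℝ) | g • I ∈ C} / volume C, ?_, ?_, ?_⟩
  · refine ENNReal.div_ne_zero.2 ⟨?_, hCt⟩
    have hopen : IsOpen {g : SL(2, ℝ) | g • I ∈ Metric.ball I 1} := Metric.isOpen_ball.preimage hcont
    refine (lt_of_lt_of_le (hopen.measure_pos Measure.haar ⟨1, by simp⟩)
      (measure_mono fun g hg => ?_)).ne'
    exact Metric.ball_subset_closedBall hg
  · exact ENNReal.div_ne_top (isProperMap_smul_I.isCompact_preimage hCc).measure_lt_top.ne hC0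
  · ext B hB
    rw [Measure.map_apply continuous_shape.measurable hB, Measure.smul_apply, smul_eq_mul,
      ENNReal.mul_div_right_comm.symm, ENNReal.eq_div_iff hC0 hCt, mul_comm,
      haar_shape_mul_volume hB hCc.measurableSet]

/-! ### A fundamental domain for the action of `SL₂(ℤ)` on `SL₂(ℝ)` -/

theorem domainU_eq_fdo : domainU = ModularGroup.fdo := by
  ext z
  simp only [domainU, ModularGroup.fdo, Set.mem_ofPred_eq, Complex.one_lt_normSq_iff]
  tauto

theorem measurableSet_domainU : MeasurableSet domainU := by
  rw [domainU_eq_fdo]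
  exact ModularGroup.isOpen_fdo.measurableSet

theorem volume_re_eq (r : ℝ) : volume {z : ℂ | z.re = r} = 0 := by
  have h : {z : ℂ | z.re = r} = Complex.measurableEquivRealProd ⁻¹' ({r} ×ˢ Set.univ) := by
    ext z
    simp
  rw [h, Complex.volume_preserving_equiv_real_prod.measure_preimage_equiv, Measure.volume_eq_prod,
    Measure.prod_prod]
  simp

theorem volume_fd_diff_fdo : volume (ModularGroup.fd \ ModularGroup.fdo) = 0 := by
  rw [volume_eq_lintegral]
  refine setLIntegral_measure_zero _ _ ?_
  refine measure_mono_null (t := Metric.sphere (0 : ℂ) 1 ∪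
    ({z : ℂ | z.re = 1 / 2} ∪ {z : ℂ | z.re = -(1 / 2)})) ?_ ?_
  · rintro _ ⟨z, ⟨⟨h1, h2⟩, h3⟩, rfl⟩
    simp only [ModularGroup.fdo, Set.mem_ofPred_eq, not_and_or, not_lt] at h3
    rcases h3 with h3 | h3
    · left
      have : Complex.normSq (z : ℂ) = 1 := le_antisymm h3 h1
      rw [Complex.normSq_eq_norm_sq, pow_eq_one_iff_of_nonneg (norm_nonneg _) two_ne_zero] at this
      simpa using this
    · right
      exact eq_or_eq_neg_of_abs_eq (le_antisymm h2 h3)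
  · simp [measure_union_null_iff, volume_re_eq, Measure.addHaar_sphere]

theorem integral_smul_eq (γ : SL(2, ℤ)) (z : ℍ) :
    Matrix.SpecialLinearGroup.map (Int.castRingHom ℝ) γ • z = γ • z := by
  ext
  rw [coe_specialLinearGroup_apply, coe_specialLinearGroup_apply]
  simp

theorem neg_smul_upperHalfPlane (g : SL(2, ℝ)) (z : ℍ) : (-g) • z = g • z := by
  ext
  rw [coe_specialLinearGroup_apply, coe_specialLinearGroup_apply, ← neg_div_neg_eq]
  simp only [Matrix.SpecialLinearGroup.coe_neg, Matrix.neg_apply, map_neg, Complex.ofReal_neg,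
    neg_mul, neg_add, neg_neg]

theorem shape_neg (g : SL(2, ℝ)) : shape (-g) = shape g := by
  have : (-g)⁻¹ = -g⁻¹ := by
    rw [inv_eq_iff_mul_eq_one]
    simp
  rw [shape, this, neg_smul_upperHalfPlane, shape]

theorem neg_mem_integralSL {g : SL(2, ℝ)} (hg : g ∈ integralSL) : -g ∈ integralSL := by
  obtain ⟨γ, rfl⟩ := hg
  refine ⟨-γ, ?_⟩
  ext i j
  simp

instance : Countable integralSL :=
  (MonoidHom.rangeRestrict_surjective
    (Matrix.SpecialLinearGroup.map (n := Fin 2) (Int.castRingHom ℝ))).countable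

/-- A strict fundamental domain for the action of `±1` on `SL₂(ℝ)`. -/
def halfSL : Set SL(2, ℝ) := {g | 0 < g 0 0 ∨ g 0 0 = 0 ∧ 0 < g 0 1}

theorem neg_mem_halfSL_iff (g : SL(2, ℝ)) : -g ∈ halfSL ↔ g ∉ halfSL := by
  have hdet := g.det_coe
  rw [Matrix.det_fin_two] at hdet
  simp only [halfSL, Set.mem_ofPred_eq, Matrix.SpecialLinearGroup.coe_neg, Matrix.neg_apply,
    Left.neg_pos_iff, neg_eq_zero, not_or, not_and, not_lt]
  constructor
  · rintro (h | ⟨h, h'⟩)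
    · exact ⟨h.le, fun h0 => absurd h0 h.ne⟩
    · exact ⟨h.le, fun _ => h'.le⟩
  · rintro ⟨h, h'⟩
    rcases h.lt_or_eq with h | h
    · exact Or.inl h
    · refine Or.inr ⟨h, lt_of_le_of_ne (h' h) fun h1 => ?_⟩
      simp [h, h1] at hdet

theorem continuous_entry (i j : Fin 2) : Continuous fun g : SL(2, ℝ) => g i j :=
  (continuous_subtype_val : Continuous fun g : SL(2, ℝ) => g.1).matrix_elem i j

theorem measurableSet_halfSL : MeasurableSet halfSL := by
  have h (i j : Fin 2) : Measurable fun g : SL(2, ℝ) => g i j := (continuous_entry i j).measurable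
  exact (measurableSet_lt measurable_const (h 0 0)).union
    ((h 0 0 (measurableSet_singleton 0)).inter (measurableSet_lt measurable_const (h 0 1)))

/-- A fundamental domain for the right action of `SL₂(ℤ)` on `SL₂(ℝ)`, up to a null set. -/
def domainSL : Set SL(2, ℝ) := shape ⁻¹' domainU ∩ halfSL

theorem measurableSet_domainSL : MeasurableSet domainSL :=
  (continuous_shape.measurable measurableSet_domainU).inter measurableSet_halfSL

theorem injOn_mk_domainSL : Set.InjOn (fun g => (QuotientGroup.mk g : TropStr)) domainSL := by
  intro g hg h hh hgh
  obtain ⟨γ, hγ⟩ := QuotientGroup.eq.1 hgh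
  have hh' : h = g * Matrix.SpecialLinearGroup.map (Int.castRingHom ℝ) γ := by
    rw [hγ, mul_inv_cancel_left]
  have h1 : shape h = γ⁻¹ • shape g := by
    rw [hh', shape_mul, ← map_inv, integral_smul_eq]
  have hg1 := hg.1
  have hh1 := hh.1
  rw [domainU_eq_fdo] at hg1 hh1
  rw [Set.mem_preimage, h1] at hh1
  rcases ModularGroup.eq_one_or_neg_one_of_mem_fdo_mem_fdo hg1 hh1 with h2 | h2
  · rw [inv_eq_one.1 h2, map_one, mul_one] at hh'
    exact hh'.symm
  · have h3 : γ = -1 := by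
      rw [inv_eq_iff_mul_eq_one] at h2
      simpa [neg_eq_iff_eq_neg] using h2
    have h4 : h = -g := by
      rw [hh', h3]
      ext i j
      simp
    exact absurd hg.2 ((neg_mem_halfSL_iff g).1 (h4 ▸ hh.2))

/-- Every shape can be moved into the closed fundamental domain. The elements with a translate
landing on its boundary form a countable union of null sets, and a factor `-1` adjusts the sign
without changing the shape. -/
theorem ae_exists_mul_mem_domainSL :
    ∀ᵐ g : SL(2, ℝ) ∂Measure.haar, ∃ γ : integralSL, g * γ ∈ domainSL := by
  have hnull : Measure.haar (shape ⁻¹' (ModularGroup.fd \ ModularGroup.fdo)) = 0 := by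
    obtain ⟨c, -, -, hc⟩ := exists_map_shape_haar
    rw [← Measure.map_apply continuous_shape.measurable
      (ModularGroup.isClosed_fd.measurableSet.diff ModularGroup.isOpen_fdo.measurableSet), hc,
      Measure.smul_apply, volume_fd_diff_fdo, smul_zero]
  have hae : ∀ᵐ g : SL(2, ℝ) ∂Measure.haar, ∀ γ : integralSL,
      shape (g * γ) ∉ ModularGroup.fd \ ModularGroup.fdo := by
    refine ae_all_iff.2 fun γ => ?_
    have h := measure_preimage_mul_right Measure.haar (γ : SL(2, ℝ))
      (shape ⁻¹' (ModularGroup.fd \ ModularGroup.fdo))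
    rw [hnull] at h
    exact measure_eq_zero_iff_ae_notMem.1 h
  filter_upwards [hae] with g hg
  obtain ⟨γ, hγ⟩ := ModularGroup.exists_smul_mem_fd (shape g)
  have hmem : Matrix.SpecialLinearGroup.map (Int.castRingHom ℝ) γ⁻¹ ∈ integralSL := ⟨γ⁻¹, rfl⟩
  set δ := Matrix.SpecialLinearGroup.map (Int.castRingHom ℝ) γ⁻¹
  have h1 : shape (g * δ) ∈ domainU := by
    have h2 : shape (g * δ) = γ • shape g := by
      rw [shape_mul, ← map_inv, inv_inv, integral_smul_eq]
    rw [domainU_eq_fdo]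
    by_contra h3
    exact hg ⟨δ, hmem⟩ ⟨h2 ▸ hγ, h3⟩
  by_cases h : g * δ ∈ halfSL
  · exact ⟨⟨δ, hmem⟩, h1, h⟩
  · refine ⟨⟨-δ, neg_mem_integralSL hmem⟩, ?_, ?_⟩
    · simpa [shape_neg] using h1
    · simpa using (neg_mem_halfSL_iff _).2 h

theorem measurable_mk : Measurable fun g => (QuotientGroup.mk g : TropStr) :=
  measurable_quotient_mk''

theorem mk_mul_integral (g : SL(2, ℝ)) (γ : integralSL) :
    (QuotientGroup.mk (g * γ) : TropStr) = QuotientGroup.mk g :=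
  QuotientGroup.mk_mul_of_mem g γ.2

/-- The supremum is attained at `domainSL`. Any competitor `E` is cut, up to a null set, into pieces
which integral elements translate into `domainSL`. Right invariance preserves their measures, and
the translates stay disjoint since `E` meets each coset at most once. -/
theorem quotientHaar_eq_map : quotientHaar =
    (Measure.haar.restrict domainSL).map fun g => (QuotientGroup.mk g : TropStr) := by
  refine le_antisymm (iSup_le fun E => iSup_le fun hE => iSup_le fun hinj => ?_)
    (le_iSup_of_le domainSL (le_iSup_of_le measurableSet_domainSL
      (le_iSup_of_le injOn_mk_domainSL le_rfl)))
  refine Measure.le_iff.2 fun A hA => ?_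
  rw [Measure.map_apply measurable_mk hA, Measure.map_apply measurable_mk hA,
    Measure.restrict_apply (measurable_mk hA), Measure.restrict_apply (measurable_mk hA)]
  set B : Set SL(2, ℝ) := (fun g => (QuotientGroup.mk g : TropStr)) ⁻¹' A with hB
  have hBm : MeasurableSet B := measurable_mk hA
  have hmul (g : SL(2, ℝ)) : Measurable fun x : SL(2, ℝ) => x * g :=
    (continuous_mul_const g).measurable
  have hBinv (g : SL(2, ℝ)) (γ : integralSL) : g * γ ∈ B ↔ g ∈ B := by
    simp only [hB, Set.mem_preimage, mk_mul_integral]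
  have hBinv' (g : SL(2, ℝ)) (γ : integralSL) : g * (γ : SL(2, ℝ))⁻¹ ∈ B ↔ g ∈ B :=
    hBinv g γ⁻¹
  calc Measure.haar (B ∩ E)
      ≤ Measure.haar (⋃ γ : integralSL, (B ∩ E) ∩ (fun x => x * (γ : SL(2, ℝ))) ⁻¹' domainSL) := by
        refine measure_mono_ae ?_
        filter_upwards [ae_exists_mul_mem_domainSL] with g hg hgE
        obtain ⟨γ, hγ⟩ := hg
        exact Set.mem_iUnion.2 ⟨γ, hgE, hγ⟩
    _ ≤ ∑' γ : integralSL,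
          Measure.haar ((B ∩ E) ∩ (fun x => x * (γ : SL(2, ℝ))) ⁻¹' domainSL) :=
        measure_iUnion_le _
    _ = ∑' γ : integralSL,
          Measure.haar ((B ∩ (fun x => x * (γ : SL(2, ℝ))⁻¹) ⁻¹' E) ∩ domainSL) := by
        refine tsum_congr fun γ => ?_
        rw [← measure_preimage_mul_right Measure.haar (γ : SL(2, ℝ))⁻¹]
        congr 1
        ext g
        simp [hBinv' g γ]
    _ = Measure.haar (⋃ γ : integralSL,
          (B ∩ (fun x => x * (γ : SL(2, ℝ))⁻¹) ⁻¹' E) ∩ domainSL) := by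
        refine (measure_iUnion ?_ fun γ =>
          (hBm.inter (hmul _ hE)).inter measurableSet_domainSL).symm
        intro γ δ hne
        refine Set.disjoint_left.2 fun g hg hg' => hne ?_
        have h := hinj hg.1.2 hg'.1.2
          ((mk_mul_integral g γ⁻¹).trans (mk_mul_integral g δ⁻¹).symm)
        exact Subtype.ext (inv_injective (mul_left_cancel h))
    _ ≤ Measure.haar (B ∩ domainSL) :=
        measure_mono (Set.iUnion_subset fun γ => Set.inter_subset_inter_left _ Set.inter_subset_left)

/-! ### Integration over the fundamental domain -/

theorem setLIntegral_halfSL_compl {S : Set SL(2, ℝ)} (hS : ∀ g, -g ∈ S ↔ g ∈ S)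
    (f : SL(2, ℝ) → ℝ≥0∞) (hf : ∀ g, f (-g) = f g) :
    ∫⁻ g in S \ halfSL, f g ∂Measure.haar = ∫⁻ g in S ∩ halfSL, f g ∂Measure.haar := by
  have h := (measurePreserving_mul_left (Measure.haar : Measure SL(2, ℝ))
    (-1)).setLIntegral_comp_preimage_emb
      (MeasurableEquiv.mulLeft (-1 : SL(2, ℝ))).measurableEmbedding f (S ∩ halfSL)
  rw [← h]
  have hset : (fun x : SL(2, ℝ) => -1 * x) ⁻¹' (S ∩ halfSL) = S \ halfSL := by
    ext g
    simp [hS, neg_mem_halfSL_iff]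
  rw [hset]
  simp only [neg_mul, one_mul, hf]

theorem exists_setLIntegral_domainSL : ∃ c : ℝ≥0∞, c ≠ 0 ∧ c ≠ ∞ ∧
    ∀ φ : ℍ → ℝ≥0∞, Measurable φ →
      ∫⁻ g in domainSL, φ (shape g) ∂Measure.haar = c * ∫⁻ z in domainU, φ z := by
  obtain ⟨c, hc0, hct, hc⟩ := exists_map_shape_haar
  -- The factor one half appears because `g` and `-g` have the same shape and exactly one of them
  -- lies in `halfSL`.
  refine ⟨c / 2, ENNReal.div_ne_zero.2 ⟨hc0, by simp⟩, ENNReal.div_ne_top hct (by simp),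
    fun φ hφ => ?_⟩
  have h1 : ∫⁻ g in shape ⁻¹' domainU, φ (shape g) ∂Measure.haar = c * ∫⁻ z in domainU, φ z := by
    rw [← setLIntegral_map measurableSet_domainU hφ continuous_shape.measurable, hc,
      Measure.restrict_smul, lintegral_smul_measure, smul_eq_mul]
  rw [← lintegral_inter_add_sdiff _ _ measurableSet_halfSL,
    setLIntegral_halfSL_compl (fun g => by simp [shape_neg]) _ (fun g => by rw [shape_neg]),
    ← two_mul] at h1
  rw [domainSL, ENNReal.mul_div_right_comm.symm, ← h1, mul_comm (2 : ℝ≥0∞),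
    ENNReal.mul_div_cancel_right (by simp) (by simp)]

/-! ### Tropical distance functions as minima -/

theorem coeff_eq_coe {Ω : Set Plane} {l : Plane} {r : ℝ} (h : ∀ q ∈ Ω, -r ≤ inner ℝ l q)
    (h' : ∃ q ∈ Ω, inner ℝ l q = -r) : coeff Ω l = r := by
  have : ⨅ q ∈ Ω, ((inner ℝ l q : ℝ) : EReal) = ((-r : ℝ) : EReal) := by
    obtain ⟨q, hq, hqr⟩ := h'
    refine le_antisymm (iInf₂_le_of_le q hq (by rw [hqr])) (le_iInf₂ fun q hq => ?_)
    exact EReal.coe_le_coe_iff.2 (h q hq)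
  rw [coeff, this, EReal.coe_neg, neg_neg]

theorem monomialAt_zero (Ω : Set Plane) (l : Plane) : monomialAt Ω l 0 = coeff Ω l := by
  simp [monomialAt]

theorem tropDist_le {L : AddSubgroup Plane} {l : Plane} (hl : l ∈ L) (hl0 : l ≠ 0)
    (Ω : Set Plane) (p : Plane) : tropDist L Ω p ≤ monomialAt Ω l p :=
  iInf₂_le l ⟨hl, hl0⟩

theorem le_tropDist {L : AddSubgroup Plane} {Ω : Set Plane} {p : Plane} {r : EReal}
    (h : ∀ l ∈ L, l ≠ 0 → r ≤ monomialAt Ω l p) : r ≤ tropDist L Ω p :=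
  le_iInf₂ fun l hl => h l hl.1 hl.2

theorem tropDist_eq {L : AddSubgroup Plane} {Ω : Set Plane} {p : Plane} {r : EReal}
    (h : ∀ l ∈ L, l ≠ 0 → r ≤ monomialAt Ω l p)
    (h' : ∃ l ∈ L, l ≠ 0 ∧ monomialAt Ω l p = r) : tropDist L Ω p = r := by
  obtain ⟨l, hl, hl0, hlr⟩ := h'
  exact le_antisymm (hlr ▸ tropDist_le hl hl0 Ω p) (le_tropDist h)

theorem coeff_disk (l : Plane) : coeff disk l = (‖l‖ : ℝ) := by
  refine coeff_eq_coe (fun q hq => ?_) ?_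
  · have hq' : ‖q‖ ≤ 1 := by simpa [disk] using hq
    refine neg_le_of_abs_le ((abs_real_inner_le_norm l q).trans ?_)
    exact mul_le_of_le_one_right (norm_nonneg l) hq'
  · rcases eq_or_ne l 0 with rfl | hl
    · exact ⟨0, by simp [disk], by simp⟩
    · have hl' : ‖l‖ ≠ 0 := norm_ne_zero_iff.2 hl
      refine ⟨-(‖l‖⁻¹ • l), by simp [disk, norm_smul, hl'], ?_⟩
      rw [inner_neg_right, inner_smul_right, real_inner_self_eq_norm_sq]
      field_simp

/-! ### The systole of a lattice -/

theorem sq_add_sq_pos (g : SL(2, ℝ)) : 0 < g 0 0 ^ 2 + g 1 0 ^ 2 := by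
  have hdet := g.det_coe
  rw [Matrix.det_fin_two] at hdet
  by_contra! h
  have h0 : g 0 0 = 0 := by nlinarith [sq_nonneg (g 0 0), sq_nonneg (g 1 0)]
  have h1 : g 1 0 = 0 := by nlinarith [sq_nonneg (g 0 0), sq_nonneg (g 1 0)]
  simp [h0, h1] at hdet

theorem coe_shape (g : SL(2, ℝ)) : (shape g : ℂ) =
    ⟨-(g 0 0 * g 0 1 + g 1 0 * g 1 1) / (g 0 0 ^ 2 + g 1 0 ^ 2), 1 / (g 0 0 ^ 2 + g 1 0 ^ 2)⟩ := by
  have hdet := g.det_coe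
  rw [Matrix.det_fin_two] at hdet
  have hs := (sq_add_sq_pos g).ne'
  have hden : (-(g 1 0 : ℂ) * Complex.I + g 0 0) ≠ 0 := by
    intro h
    have hre := congrArg Complex.re h
    have him := congrArg Complex.im h
    simp at hre him
    simp [hre, him] at hs
  rw [shape, coe_specialLinearGroup_apply]
  simp only [Matrix.SpecialLinearGroup.coe_inv, Matrix.adjugate_fin_two, Matrix.of_apply,
    Matrix.cons_val', Matrix.cons_val_zero, Matrix.cons_val_one, Matrix.cons_val_fin_one,
    Algebra.algebraMap_self, RingHom.id_apply, coe_I, Complex.ofReal_neg]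
  rw [div_eq_iff hden]
  apply Complex.ext
  · simp
    field_simp
    linear_combination (g 1 0 : ℝ) * hdet
  · simp
    field_simp
    linear_combination (g 0 0 : ℝ) * hdet

theorem shape_im (g : SL(2, ℝ)) : (shape g).im = 1 / (g 0 0 ^ 2 + g 1 0 ^ 2) := by
  rw [← coe_im, coe_shape]

theorem shape_re (g : SL(2, ℝ)) :
    (shape g).re = -(g 0 0 * g 0 1 + g 1 0 * g 1 1) / (g 0 0 ^ 2 + g 1 0 ^ 2) := by
  rw [← coe_re, coe_shape]

/-- With `z = shape g`, the right side is `|v 0 - v 1 z|² / Im z`: the Gram form of the lattice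
basis is determined by the shape. -/
theorem norm_sq_act (g : SL(2, ℝ)) (v : Plane) : ‖act g v‖ ^ 2 =
    ((v 0 - v 1 * (shape g).re) ^ 2 + (v 1 * (shape g).im) ^ 2) / (shape g).im := by
  have hdet := g.det_coe
  rw [Matrix.det_fin_two] at hdet
  have hs := (sq_add_sq_pos g).ne'
  rw [shape_re, shape_im, EuclideanSpace.norm_sq_eq, Fin.sum_univ_two]
  simp only [act, Matrix.toLpLin_apply, Matrix.mulVec, dotProduct, Fin.sum_univ_two,
    Real.norm_eq_abs, sq_abs]
  field_simp
  linear_combination (v 1 ^ 2 * (g 0 0 * g 1 1 - g 0 1 * g 1 0 + 1)) * hdet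

theorem act_one (v : Plane) : act 1 v = v := by
  ext i
  simp [act]

theorem act_injective (g : SL(2, ℝ)) : Function.Injective (act g) := by
  refine Function.LeftInverse.injective (g := act g⁻¹) fun v => ?_
  rw [← act_mul, inv_mul_cancel, act_one]

theorem act_ne_zero_iff (g : SL(2, ℝ)) (v : Plane) : act g v ≠ 0 ↔ v ≠ 0 :=
  (map_ne_zero_iff (act g) (act_injective g))

theorem continuous_act (v : Plane) : Continuous fun g : SL(2, ℝ) => act g v := by
  have h : Continuous fun g : SL(2, ℝ) => (g : Matrix (Fin 2) (Fin 2) ℝ) := continuous_subtype_val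
  simp only [act, Matrix.toLpLin_apply]
  fun_prop

instance : Countable stdLattice := by
  have h : ∀ v : stdLattice, ∃ n : Fin 2 → ℤ, ∀ i, v.1 i = n i := fun v => by
    choose n hn using v.2
    exact ⟨n, hn⟩
  choose f hf using h
  refine Function.Injective.countable (f := f) fun v w hvw => ?_
  ext i
  rw [hf, hf, hvw]

/-- Indexing by the fixed countable set `stdLattice` makes measurability in `g` immediate. -/
theorem tropDist_disk_zero (g : SL(2, ℝ)) : tropDist (latticeOf g) disk 0 =
    ⨅ v : {v : stdLattice // v ≠ 0}, ((‖act g v.1‖ : ℝ) : EReal) := by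
  refine le_antisymm (le_iInf fun v => ?_) (le_tropDist ?_)
  · rw [← coeff_disk, ← monomialAt_zero]
    exact tropDist_le (Set.mem_image_of_mem (act g) v.1.2) ((act_ne_zero_iff g _).2 (by simpa using v.2)) _ _
  · rintro _ ⟨v, hv, rfl⟩ hv0
    refine iInf_le_of_le ⟨⟨v, hv⟩, fun h => hv0 ?_⟩ ?_
    · simpa using congrArg (act g) (congrArg Subtype.val h)
    · rw [monomialAt_zero, coeff_disk]
      rfl

theorem measurable_tropDist_disk :
    Measurable fun x : TropStr => (tropDist x.lattice disk 0).toENNReal := by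
  refine measurable_from_quotient.2 ?_
  have h : Measurable fun g : SL(2, ℝ) => tropDist (latticeOf g) disk 0 := by
    simp_rw [tropDist_disk_zero]
    exact Measurable.iInf fun v => (continuous_act _).norm.measurable.coe_real_ereal
  exact h.ereal_toENNReal

/-- Since `|Re z| < 1/2` and `|z| > 1`, the form is at least `m² - |m n| + n²`, a positive integer.
-/
theorem one_le_of_mem_domainU {z : ℍ} (hz : z ∈ domainU) {m n : ℤ} (h : m ≠ 0 ∨ n ≠ 0) :
    1 ≤ (m - n * z.re) ^ 2 + (n * z.im) ^ 2 := by
  obtain ⟨hre, hnorm⟩ := hz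
  have hsq : 1 < z.re ^ 2 + z.im ^ 2 := by
    have := Complex.one_lt_normSq_iff.2 hnorm
    simpa [Complex.normSq_apply, ← sq] using this
  have hint : (1 : ℝ) ≤ |(m : ℝ)| ^ 2 - |(m : ℝ)| * |(n : ℝ)| + |(n : ℝ)| ^ 2 := by
    have h1 : (1 : ℤ) ≤ |m| ^ 2 - |m| * |n| + |n| ^ 2 := by
      have h2 : 0 < |m| + |n| := by
        rcases h with h | h
        · have := abs_pos.2 h; positivity
        · have := abs_pos.2 h; positivity
      have h3 : 0 < |m| ^ 2 - |m| * |n| + |n| ^ 2 := by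
        nlinarith [sq_nonneg (|m| - |n|), abs_nonneg m, abs_nonneg n, mul_pos h2 h2]
      exact h3
    exact_mod_cast h1
  have hcross : 2 * (m * n * z.re) ≤ |(m : ℝ)| * |(n : ℝ)| := by
    calc 2 * (m * n * z.re) ≤ 2 * |m * n * z.re| := by gcongr; exact le_abs_self _
      _ = |(m : ℝ)| * |(n : ℝ)| * (2 * |z.re|) := by rw [abs_mul, abs_mul]; ring
      _ ≤ |(m : ℝ)| * |(n : ℝ)| * 1 := by gcongr; linarith
      _ = |(m : ℝ)| * |(n : ℝ)| := mul_one _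
  rw [sq_abs, sq_abs] at hint
  nlinarith [sq_nonneg (n : ℝ)]

theorem tropDist_disk_of_mem_domainU {g : SL(2, ℝ)} (hg : shape g ∈ domainU) :
    (tropDist (latticeOf g) disk 0).toENNReal =
      ENNReal.ofReal ((shape g).im ^ (-(1 / 2) : ℝ)) := by
  have him := (shape g).im_pos
  have hroot : (shape g).im ^ (-(1 / 2) : ℝ) = √(1 / (shape g).im) := by
    rw [Real.sqrt_eq_rpow, one_div (shape g).im, Real.inv_rpow him.le, Real.rpow_neg him.le]
  have h : tropDist (latticeOf g) disk 0 = ((√(1 / (shape g).im) : ℝ) : EReal) := by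
    refine tropDist_eq ?_ ?_
    · rintro _ ⟨v, hv, rfl⟩ hv0
      rw [monomialAt_zero, coeff_disk, EReal.coe_le_coe_iff]
      refine Real.sqrt_le_iff.2 ⟨norm_nonneg _, ?_⟩
      have hv1 : v ≠ 0 := (act_ne_zero_iff g v).1 hv0
      obtain ⟨m, hm⟩ := hv 0
      obtain ⟨n, hn⟩ := hv 1
      refine le_of_le_of_eq ?_ (norm_sq_act g v).symm
      rw [hm, hn]
      gcongr
      refine one_le_of_mem_domainU hg ?_
      by_contra! h
      refine hv1 ?_
      ext i
      fin_cases i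
      · simpa [h.1] using hm
      · simpa [h.2] using hn
    -- The image of the first basis vector is a shortest vector: its squared length is `1 / Im z`.
    · have h1 : (!₂[1, 0] : Plane) ∈ stdLattice := by
        intro i
        fin_cases i
        · exact ⟨1, by simp⟩
        · exact ⟨0, by simp⟩
      have h2 : (!₂[1, 0] : Plane) ≠ 0 := fun h => by simpa using congrArg (fun v : Plane => v 0) h
      refine ⟨_, Set.mem_image_of_mem (act g) h1, (act_ne_zero_iff g _).2 h2, ?_⟩
      have h3 := norm_sq_act g !₂[1, 0]
      rw [monomialAt_zero, coeff_disk, EReal.coe_eq_coe_iff, ← Real.sqrt_sq (norm_nonneg _), h3]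
      simp
  rw [h, hroot, EReal.toENNReal_of_ne_top (EReal.coe_ne_top _), EReal.toReal_coe]

/-- The total mass and the integral carry the same Haar constant `c`, which cancels in their
quotient; the factors `π² / 6` and `6 / π²` cancel as well. -/
theorem equiAffineDist_one_disk_zero : equiAffineDist 1 disk 0 =
    (volume domainU)⁻¹ * ∫⁻ z in domainU, ENNReal.ofReal (z.im ^ (-(1 / 2) : ℝ)) := by
  obtain ⟨c, hc0, hct, hc⟩ := exists_setLIntegral_domainSL
  have huniv : quotientHaar Set.univ = c * volume domainU := by
    have := hc 1 measurable_one
    simp only [Pi.one_apply, lintegral_one, Measure.restrict_apply_univ] at this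
    rw [quotientHaar_eq_map, Measure.map_apply measurable_mk MeasurableSet.univ]
    simpa using this
  have hint : ∫⁻ x, (tropDist x.lattice disk 0).toENNReal ∂quotientHaar =
      c * ∫⁻ z in domainU, ENNReal.ofReal (z.im ^ (-(1 / 2) : ℝ)) := by
    rw [quotientHaar_eq_map, lintegral_map measurable_tropDist_disk measurable_mk, ← hc]
    · exact setLIntegral_congr_fun measurableSet_domainSL
        fun g hg => tropDist_disk_of_mem_domainU hg.1
    · exact (continuous_im.measurable.pow_const _).ennreal_ofReal
  simp only [equiAffineDist, ENNReal.rpow_one, inv_one, tropMeasure, lintegral_smul_measure,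
    smul_eq_mul, hint, huniv]
  have hpi : ENNReal.ofReal (6 / Real.pi ^ 2) * ENNReal.ofReal (Real.pi ^ 2 / 6) = 1 := by
    rw [← ENNReal.ofReal_mul (by positivity)]
    field_simp
    simp
  rw [← mul_assoc, ← mul_div_assoc, hpi, one_div, ENNReal.mul_inv (Or.inl hc0) (Or.inl hct),
    mul_mul_mul_comm, ENNReal.inv_mul_cancel hc0 hct, one_mul]

/-! ### Integrals over the fundamental domain in the upper half-plane -/

theorem setLIntegral_upperHalfPlane {S : Set ℍ} (hS : MeasurableSet S) {f : ℍ → ℝ≥0∞}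
    (hf : Measurable f) (G : ℂ → ℝ≥0∞)
    (hG : ∀ z : ℍ, G z = f z * ENNReal.ofReal (1 / z.im ^ 2)) :
    ∫⁻ z in S, f z = ∫⁻ w in (↑) '' S, G w := by
  have hmp : MeasurePreserving UpperHalfPlane.coe (volume.comap UpperHalfPlane.coe)
      (volume.restrict (.range UpperHalfPlane.coe)) :=
    ⟨measurable_coe, by rw [measurableEmbedding_coe.map_comap]⟩
  have hd : ∀ z : ℍ, (((1 / NNReal.mk z.im z.im_pos.le : NNReal) ^ 2 : NNReal) : ℝ≥0∞) =
      ENNReal.ofReal (1 / z.im ^ 2) := by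
    intro z
    rw [ENNReal.ofReal, ENNReal.coe_inj]
    ext
    rw [Real.coe_toNNReal _ (by positivity)]
    simp
  have hdm : Measurable fun z : ℍ => ENNReal.ofReal (1 / z.im ^ 2) :=
    ((continuous_im.measurable.pow_const 2).const_div 1).ennreal_ofReal
  rw [volume_def]
  simp_rw [hd]
  rw [setLIntegral_withDensity_eq_setLIntegral_mul _ hdm hf hS]
  have h := hmp.setLIntegral_comp_emb measurableEmbedding_coe G S
  rw [Measure.restrict_restrict' measurableEmbedding_coe.measurableSet_range,
    Set.inter_eq_self_of_subset_left (Set.image_subset_range _ _)] at h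
  rw [← h]
  refine lintegral_congr fun z => ?_
  rw [hG, Pi.mul_apply, mul_comm]

theorem lintegral_Ioi_rpow {s c : ℝ} (hs : 0 ≤ s) (hc : 0 < c) :
    ∫⁻ y in Set.Ioi c, ENNReal.ofReal (y ^ (-s - 2)) =
      ENNReal.ofReal (c ^ (-s - 1) / (s + 1)) := by
  rw [← ofReal_integral_eq_lintegral_ofReal (integrableOn_Ioi_rpow_of_lt (by linarith) hc),
    integral_Ioi_rpow_of_lt (by linarith) hc]
  · congr 1
    rw [show -s - 2 + 1 = -s - 1 by ring, show -s - 1 = -(s + 1) by ring, neg_div_neg_eq]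
  · filter_upwards [ae_restrict_mem measurableSet_Ioi] with y hy
    exact Real.rpow_nonneg (hc.trans hy).le _

theorem mem_coe_image_domainU {x y : ℝ} :
    (⟨x, y⟩ : ℂ) ∈ ((↑) '' domainU : Set ℂ) ↔
      x ∈ Set.Ioo (-(1 / 2) : ℝ) (1 / 2) ∧ y ∈ Set.Ioi √(1 - x ^ 2) := by
  rw [domainU_eq_fdo, ModularGroup.coe_fdo]
  simp only [Set.mem_ofPred_eq, Set.mem_Ioo, Set.mem_Ioi, ← Complex.one_lt_normSq_iff,
    Complex.normSq_mk, abs_lt]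
  constructor
  · rintro ⟨hy, h1, hx⟩
    exact ⟨hx, (Real.sqrt_lt' hy).2 (by linarith)⟩
  · rintro ⟨hx, h⟩
    have hy : 0 < y := (Real.sqrt_nonneg _).trans_lt h
    exact ⟨hy, by linarith [(Real.sqrt_lt' hy).1 h], hx⟩

theorem one_sub_sq_pos {x : ℝ} (hx : x ∈ Set.Icc (-(1 / 2) : ℝ) (1 / 2)) : 0 < 1 - x ^ 2 := by
  nlinarith [hx.1, hx.2]

/-- The fibre of the domain over `x` is the half-line above the unit circle, so the inner integral
is that of the power `-s - 2`, with the hyperbolic density included. -/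
theorem setLIntegral_domainU_eq_lintegral {s : ℝ} (hs : 0 ≤ s) :
    ∫⁻ z in domainU, ENNReal.ofReal (z.im ^ (-s)) =
      ∫⁻ x in Set.Ioo (-(1 / 2) : ℝ) (1 / 2),
        ENNReal.ofReal (√(1 - x ^ 2) ^ (-s - 1) / (s + 1)) := by
  have hmeas : MeasurableSet ((↑) '' domainU : Set ℂ) :=
    measurableEmbedding_coe.measurableSet_image.2 measurableSet_domainU
  have hG : Measurable fun w : ℂ => ENNReal.ofReal (w.im ^ (-s - 2)) :=
    (Complex.measurable_im.pow_const _).ennreal_ofReal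
  rw [setLIntegral_upperHalfPlane measurableSet_domainU
    (continuous_im.measurable.pow_const _).ennreal_ofReal
    (fun w => ENNReal.ofReal (w.im ^ (-s - 2))), ← lintegral_indicator hmeas,
    ← Complex.volume_preserving_equiv_real_prod.symm.lintegral_comp_emb
      Complex.measurableEquivRealProd.symm.measurableEmbedding, Measure.volume_eq_prod,
    lintegral_prod, ← lintegral_indicator measurableSet_Ioo]
  · refine lintegral_congr fun x => ?_
    by_cases hx : x ∈ Set.Ioo (-(1 / 2) : ℝ) (1 / 2)
    · rw [Set.indicator_of_mem hx, ← lintegral_Ioi_rpow hs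
        (Real.sqrt_pos.2 (one_sub_sq_pos (Set.Ioo_subset_Icc_self hx))),
        ← lintegral_indicator measurableSet_Ioi]
      refine lintegral_congr fun y => ?_
      rw [Complex.measurableEquivRealProd_symm_apply]
      by_cases hy : y ∈ Set.Ioi √(1 - x ^ 2)
      · rw [Set.indicator_of_mem hy, Set.indicator_of_mem (mem_coe_image_domainU.2 ⟨hx, hy⟩)]
      · rw [Set.indicator_of_notMem hy,
          Set.indicator_of_notMem fun h => hy (mem_coe_image_domainU.1 h).2]
    · rw [Set.indicator_of_notMem hx]
      refine (lintegral_congr fun y => ?_).trans lintegral_zero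
      rw [Complex.measurableEquivRealProd_symm_apply,
        Set.indicator_of_notMem fun h => hx (mem_coe_image_domainU.1 h).1]
  · exact ((hG.indicator hmeas).comp Complex.measurableEquivRealProd.symm.measurable).aemeasurable
  · intro z
    rw [← ENNReal.ofReal_mul (Real.rpow_nonneg z.im_pos.le _), coe_im, Real.rpow_sub z.im_pos]
    norm_num [div_eq_mul_inv]

theorem continuousOn_sqrt_one_sub_sq_rpow (r : ℝ) :
    ContinuousOn (fun x : ℝ => √(1 - x ^ 2) ^ r) (Set.Icc (-(1 / 2)) (1 / 2)) := by
  refine ContinuousOn.rpow_const (by fun_prop) fun x hx => Or.inl ?_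
  exact (Real.sqrt_pos.2 (one_sub_sq_pos hx)).ne'

theorem cos_pos_of_abs_le_pi_div_six {t : ℝ} (ht : t ∈ Set.Icc (-(Real.pi / 6)) (Real.pi / 6)) :
    0 < Real.cos t :=
  Real.cos_pos_of_mem_Ioo ⟨by linarith [ht.1, Real.pi_pos], by linarith [ht.2, Real.pi_pos]⟩

theorem continuousOn_cos_rpow (r : ℝ) :
    ContinuousOn (fun t : ℝ => Real.cos t ^ r) (Set.Icc (-(Real.pi / 6)) (Real.pi / 6)) :=
  ContinuousOn.rpow_const (by fun_prop) fun _ ht => Or.inl (cos_pos_of_abs_le_pi_div_six ht).ne'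

/-- Substitute `x = sin t`: the Jacobian `cos t` absorbs one power, and evenness of the cosine folds
the interval in half. -/
theorem integral_sqrt_one_sub_sq_rpow (s : ℝ) :
    ∫ x in (-(1 / 2) : ℝ)..(1 / 2), √(1 - x ^ 2) ^ (-s - 1) =
      2 * ∫ t in (0 : ℝ)..(Real.pi / 6), Real.cos t ^ (-s) := by
  have hpi := Real.pi_pos
  have hle : -(Real.pi / 6) ≤ Real.pi / 6 := by linarith
  have hsub := intervalIntegral.integral_comp_mul_deriv' (a := -(Real.pi / 6)) (b := Real.pi / 6)
    (f := Real.sin) (f' := Real.cos) (g := fun x => √(1 - x ^ 2) ^ (-s - 1))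
    (fun t _ => Real.hasDerivAt_sin t) Real.continuous_cos.continuousOn ?_
  · rw [Real.sin_neg, Real.sin_pi_div_six] at hsub
    rw [← hsub]
    have hcongr : ∫ t in (-(Real.pi / 6))..(Real.pi / 6),
        ((fun x => √(1 - x ^ 2) ^ (-s - 1)) ∘ Real.sin) t * Real.cos t =
          ∫ t in (-(Real.pi / 6))..(Real.pi / 6), Real.cos t ^ (-s) := by
      refine intervalIntegral.integral_congr fun t ht => ?_
      rw [Set.uIcc_of_le hle] at ht
      have hcos := cos_pos_of_abs_le_pi_div_six ht
      simp only [Function.comp_apply, ← Real.cos_sq', Real.sqrt_sq hcos.le]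
      rw [Real.rpow_sub_one hcos.ne', div_mul_cancel₀ _ hcos.ne']
    have hint : IntervalIntegrable (fun t => Real.cos t ^ (-s)) volume
        (-(Real.pi / 6)) (Real.pi / 6) :=
      ContinuousOn.intervalIntegrable (by rw [Set.uIcc_of_le hle]; exact continuousOn_cos_rpow _)
    have h0 : (0 : ℝ) ∈ Set.uIcc (-(Real.pi / 6)) (Real.pi / 6) := by
      rw [Set.uIcc_of_le hle]
      constructor <;> linarith
    have hneg := intervalIntegral.integral_comp_neg (a := 0) (b := Real.pi / 6)
      fun t => Real.cos t ^ (-s)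
    simp only [Real.cos_neg, neg_zero] at hneg
    rw [hcongr, ← intervalIntegral.integral_add_adjacent_intervals
      (hint.mono_set (Set.uIcc_subset_uIcc_left h0))
      (hint.mono_set (Set.uIcc_subset_uIcc_right h0)), ← hneg, two_mul]
  · refine (continuousOn_sqrt_one_sub_sq_rpow _).mono ?_
    rintro _ ⟨t, ht, rfl⟩
    rw [Set.uIcc_of_le hle] at ht
    rw [← Real.sin_pi_div_six, ← Real.sin_neg]
    exact ⟨Real.sin_le_sin_of_le_of_le_pi_div_two (by linarith) (by linarith [ht.2]) ht.1,
      Real.sin_le_sin_of_le_of_le_pi_div_two (by linarith [ht.1]) (by linarith) ht.2⟩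

theorem setLIntegral_domainU {s : ℝ} (hs : 0 ≤ s) :
    ∫⁻ z in domainU, ENNReal.ofReal (z.im ^ (-s)) =
      ENNReal.ofReal (2 / (s + 1) * ∫ t in (0 : ℝ)..(Real.pi / 6), Real.cos t ^ (-s)) := by
  have hint : IntegrableOn (fun x : ℝ => √(1 - x ^ 2) ^ (-s - 1) / (s + 1))
      (Set.Ioo (-(1 / 2)) (1 / 2)) :=
    (((continuousOn_sqrt_one_sub_sq_rpow _).div_const _).integrableOn_Icc).mono_set
      Set.Ioo_subset_Icc_self
  rw [setLIntegral_domainU_eq_lintegral hs, ← ofReal_integral_eq_lintegral_ofReal hint,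
    ← integral_Ioc_eq_integral_Ioo, ← intervalIntegral.integral_of_le (by norm_num),
    intervalIntegral.integral_div, integral_sqrt_one_sub_sq_rpow]
  · congr 1
    ring
  · filter_upwards with x
    positivity

theorem volume_domainU : volume domainU = ENNReal.ofReal (Real.pi / 3) := by
  have h := setLIntegral_domainU le_rfl
  simp only [neg_zero, Real.rpow_zero, ENNReal.ofReal_one, lintegral_one,
    Measure.restrict_apply_univ, intervalIntegral.integral_const] at h
  rw [h]
  congr 1
  simp
  ring

theorem setLIntegral_domainU_half :
    (volume domainU)⁻¹ * ∫⁻ z in domainU, ENNReal.ofReal (z.im ^ (-(1 / 2) : ℝ)) =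
      ENNReal.ofReal
        (4 / Real.pi * ∫ t in (0 : ℝ)..(Real.pi / 6), 1 / Real.sqrt (Real.cos t)) := by
  have hcongr : ∫ t in (0 : ℝ)..(Real.pi / 6), Real.cos t ^ (-(1 / 2) : ℝ) =
      ∫ t in (0 : ℝ)..(Real.pi / 6), 1 / Real.sqrt (Real.cos t) := by
    refine intervalIntegral.integral_congr fun t ht => ?_
    rw [Set.uIcc_of_le (by positivity)] at ht
    have hcos : 0 ≤ Real.cos t :=
      Real.cos_nonneg_of_neg_pi_div_two_le_of_le (by linarith [ht.1, Real.pi_pos])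
        (by linarith [ht.2, Real.pi_pos])
    simp only [Real.sqrt_eq_rpow, one_div, Real.rpow_neg hcos]
  rw [volume_domainU, setLIntegral_domainU (by norm_num), hcongr,
    ← ENNReal.ofReal_inv_of_pos (by positivity), ← ENNReal.ofReal_mul (by positivity)]
  congr 1
  field_simp
  ring

/-! ### Numerical bounds -/

theorem sq_le_of_mem_Icc_pi_div_six {t : ℝ} (ht : t ∈ Set.Icc 0 (Real.pi / 6)) :
    t ^ 2 ≤ 0.275 := by
  have h : t ≤ 0.524 := ht.2.trans (by linarith [Real.pi_lt_d4])
  nlinarith [ht.1]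

theorem cos_pos_of_mem_Icc_pi_div_six {t : ℝ} (ht : t ∈ Set.Icc 0 (Real.pi / 6)) :
    0 < Real.cos t :=
  cos_pos_of_abs_le_pi_div_six ⟨by linarith [ht.1, Real.pi_pos], ht.2⟩

/-- The expansion of `cos t ^ (-1/2)` begins `1 + t²/4 + 7 t⁴/96`. The coefficient `1/24` here and
`27/250` in `one_div_sqrt_cos_le` lie on either side of `7/96`, with room for the crude bounds on
the cosine. -/
theorem le_one_div_sqrt_cos {t : ℝ} (ht : t ∈ Set.Icc 0 (Real.pi / 6)) :
    1 + 1 / 4 * t ^ 2 + 1 / 24 * t ^ 4 ≤ 1 / √(Real.cos t) := by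
  have hcos := cos_pos_of_mem_Icc_pi_div_six ht
  have ht2 := sq_le_of_mem_Icc_pi_div_six ht
  have h1 : |t| ≤ 1 := by
    rw [← sq_le_one_iff_abs_le_one]
    linarith
  have hb := (abs_le.1 (Real.cos_bound h1)).2
  rw [show |t| ^ 4 = (t ^ 2) ^ 2 by rw [← sq_abs t]; ring] at hb
  rw [le_div_iff₀ (Real.sqrt_pos.2 hcos), ← abs_of_pos (Real.sqrt_pos.2 hcos)]
  refine (le_abs_self _).trans (abs_le_of_sq_le_sq' ?_ zero_le_one |> abs_le.2)
  rw [mul_pow, sq_abs, Real.sq_sqrt hcos.le, one_pow]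
  rw [show t ^ 4 = (t ^ 2) ^ 2 by ring]
  have hu : 0 ≤ t ^ 2 := sq_nonneg t
  generalize t ^ 2 = u at *
  have hc : Real.cos t ≤ 1 - u / 2 + u ^ 2 * (5 / 96) := by linarith
  refine (mul_le_mul_of_nonneg_left hc (sq_nonneg _)).trans ?_
  have h2 : 0 ≤ u ^ 2 := sq_nonneg u
  have h3 : 0 ≤ u ^ 3 := by positivity
  have h4 : 0 ≤ u ^ 4 := by positivity
  nlinarith [mul_nonneg h2 hu, mul_le_mul_of_nonneg_left ht2 h2, mul_le_mul_of_nonneg_left ht2 h3,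
    mul_le_mul_of_nonneg_left ht2 h4]

theorem one_div_sqrt_cos_le {t : ℝ} (ht : t ∈ Set.Icc 0 (Real.pi / 6)) :
    1 / √(Real.cos t) ≤ 1 + 1 / 4 * t ^ 2 + 27 / 250 * t ^ 4 := by
  have hcos := cos_pos_of_mem_Icc_pi_div_six ht
  have ht2 := sq_le_of_mem_Icc_pi_div_six ht
  have hb := Real.one_sub_sq_div_two_le_cos (x := t)
  rw [div_le_iff₀ (Real.sqrt_pos.2 hcos)]
  refine le_of_sq_le_sq ?_ (by positivity)
  rw [mul_pow, Real.sq_sqrt hcos.le, one_pow]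
  rw [show t ^ 4 = (t ^ 2) ^ 2 by ring]
  have hu : 0 ≤ t ^ 2 := sq_nonneg t
  generalize t ^ 2 = u at *
  refine le_trans ?_ (mul_le_mul_of_nonneg_left hb (sq_nonneg _))
  have h2 : 0 ≤ u ^ 2 := sq_nonneg u
  have h3 : 0 ≤ u ^ 3 := by positivity
  have h4 : 0 ≤ u ^ 4 := by positivity
  nlinarith [mul_nonneg h2 hu, mul_le_mul_of_nonneg_left ht2 h2, mul_le_mul_of_nonneg_left ht2 h3,
    mul_le_mul_of_nonneg_left ht2 h4]

theorem integral_even_quartic (k b : ℝ) :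
    ∫ t in (0 : ℝ)..b, (1 + 1 / 4 * t ^ 2 + k * t ^ 4) = b + b ^ 3 / 12 + k * b ^ 5 / 5 := by
  rw [intervalIntegral.integral_add (Continuous.intervalIntegrable (by fun_prop) _ _)
    (Continuous.intervalIntegrable (by fun_prop) _ _), intervalIntegral.integral_add
    (Continuous.intervalIntegrable (by fun_prop) _ _)
    (Continuous.intervalIntegrable (by fun_prop) _ _)]
  simp only [intervalIntegral.integral_const_mul, integral_pow, intervalIntegral.integral_const,
    smul_eq_mul]
  norm_num
  ring

theorem intervalIntegrable_one_div_sqrt_cos :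
    IntervalIntegrable (fun t => 1 / √(Real.cos t)) volume 0 (Real.pi / 6) := by
  refine ContinuousOn.intervalIntegrable ?_
  rw [Set.uIcc_of_le (by positivity)]
  exact ContinuousOn.div continuousOn_const (by fun_prop)
    fun t ht => (Real.sqrt_pos.2 (cos_pos_of_mem_Icc_pi_div_six ht)).ne'

theorem lt_four_div_pi_mul_integral :
    0.682 < 4 / Real.pi * ∫ t in (0 : ℝ)..(Real.pi / 6), 1 / √(Real.cos t) := by
  have h := intervalIntegral.integral_mono_on (by positivity)
    (Continuous.intervalIntegrable (by fun_prop) 0 (Real.pi / 6))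
    intervalIntegrable_one_div_sqrt_cos fun t ht => le_one_div_sqrt_cos ht
  rw [integral_even_quartic] at h
  refine lt_of_lt_of_le ?_ (mul_le_mul_of_nonneg_left h (by positivity))
  have hpi : (3.1415 : ℝ) < Real.pi := Real.pi_gt_d4
  have h2 : (3.1415 : ℝ) ^ 2 < Real.pi ^ 2 := by gcongr
  have h4 : (3.1415 : ℝ) ^ 4 < Real.pi ^ 4 := by gcongr
  have e : 4 / Real.pi * (Real.pi / 6 + (Real.pi / 6) ^ 3 / 12 + 1 / 24 * (Real.pi / 6) ^ 5 / 5) =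
      2 / 3 + Real.pi ^ 2 / 648 + Real.pi ^ 4 / 233280 := by
    field_simp
    ring
  rw [e]
  norm_num at h2 h4 ⊢
  linarith

theorem four_div_pi_mul_integral_lt :
    4 / Real.pi * ∫ t in (0 : ℝ)..(Real.pi / 6), 1 / √(Real.cos t) < 0.683 := by
  have h := intervalIntegral.integral_mono_on (by positivity)
    intervalIntegrable_one_div_sqrt_cos
    (Continuous.intervalIntegrable (by fun_prop) 0 (Real.pi / 6)) fun t ht => one_div_sqrt_cos_le ht
  rw [integral_even_quartic] at h
  refine lt_of_le_of_lt (mul_le_mul_of_nonneg_left h (by positivity)) ?_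
  have hpi : Real.pi < 3.1416 := Real.pi_lt_d4
  have h2 : Real.pi ^ 2 < (3.1416 : ℝ) ^ 2 := by gcongr
  have h4 : Real.pi ^ 4 < (3.1416 : ℝ) ^ 4 := by gcongr
  have e : 4 / Real.pi * (Real.pi / 6 + (Real.pi / 6) ^ 3 / 12 + 27 / 250 * (Real.pi / 6) ^ 5 / 5) =
      2 / 3 + Real.pi ^ 2 / 648 + Real.pi ^ 4 / 90000 := by
    field_simp
    ring
  rw [e]
  norm_num at h2 h4 ⊢
  linarith

/-! ### Ellipses -/

theorem eq_mk_iff (l : Plane) (x y : ℝ) : l = !₂[x, y] ↔ l 0 = x ∧ l 1 = y := by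
  constructor
  · rintro rfl
    simp
  · rintro ⟨h0, h1⟩
    ext i
    fin_cases i
    · simpa using h0
    · simpa using h1

theorem inner_plane (l p : Plane) : inner ℝ l p = l 0 * p 0 + l 1 * p 1 := by
  simp [PiLp.inner_apply, Fin.sum_univ_two, mul_comm]

theorem mk_mem_stdLattice (m n : ℤ) : (!₂[(m : ℝ), (n : ℝ)] : Plane) ∈ stdLattice := by
  intro i
  fin_cases i
  · exact ⟨m, by simp⟩
  · exact ⟨n, by simp⟩

theorem exists_eq_mk_of_mem_stdLattice {l : Plane} (hl : l ∈ stdLattice) :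
    ∃ m n : ℤ, l = !₂[(m : ℝ), (n : ℝ)] := by
  obtain ⟨m, hm⟩ := hl 0
  obtain ⟨n, hn⟩ := hl 1
  exact ⟨m, n, (eq_mk_iff _ _ _).2 ⟨hm, hn⟩⟩

theorem mk_ne_zero_iff (m n : ℤ) : (!₂[(m : ℝ), (n : ℝ)] : Plane) ≠ 0 ↔ m ≠ 0 ∨ n ≠ 0 := by
  rw [ne_comm, Ne, eq_mk_iff, ← not_and_or]
  simp [eq_comm]

/-- The quadratic form dual to `a x² + b x y + c y²`, for `4 a c - b² = 4`. -/
def dualForm (a b c x y : ℝ) : ℝ := c * x ^ 2 - b * (x * y) + a * y ^ 2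

theorem dualForm_nonneg {a b c : ℝ} (ha : 0 < a) (hdisc : 4 * a * c - b ^ 2 = 4) (x y : ℝ) :
    0 ≤ dualForm a b c x y := by
  have h : 4 * a * dualForm a b c x y = (2 * a * y - b * x) ^ 2 + 4 * x ^ 2 := by
    rw [dualForm]
    linear_combination x ^ 2 * hdisc
  by_contra! hneg
  nlinarith [sq_nonneg (2 * a * y - b * x), sq_nonneg x]

theorem coeff_ellipse {a b c : ℝ} (ha : 0 < a) (hdisc : 4 * a * c - b ^ 2 = 4) (l : Plane) :
    coeff (ellipse a b c) l = (√(dualForm a b c (l 0) (l 1)) : ℝ) := by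
  have hN := dualForm_nonneg ha hdisc (l 0) (l 1)
  refine coeff_eq_coe (fun q hq => ?_) ?_
  · refine neg_le_of_abs_le (Real.abs_le_sqrt ?_)
    have hq' : a * q 0 ^ 2 + b * (q 0 * q 1) + c * q 1 ^ 2 ≤ 1 := hq
    -- Cauchy–Schwarz for the form and its dual, with the defect as an explicit square; `hdisc` says
    -- that the determinant is one.
    have hid : dualForm a b c (l 0) (l 1) * (a * q 0 ^ 2 + b * (q 0 * q 1) + c * q 1 ^ 2) -
        inner ℝ l q ^ 2 =
          (l 0 * (b / 2 * q 0 + c * q 1) - l 1 * (a * q 0 + b / 2 * q 1)) ^ 2 := by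
      rw [dualForm, inner_plane]
      linear_combination (l 0 * q 0 + l 1 * q 1) ^ 2 / 4 * hdisc
    nlinarith [mul_le_mul_of_nonneg_left hq' hN, sq_nonneg
      (l 0 * (b / 2 * q 0 + c * q 1) - l 1 * (a * q 0 + b / 2 * q 1))]
  · set s := √(dualForm a b c (l 0) (l 1)) with hs
    have hs2 : s ^ 2 = dualForm a b c (l 0) (l 1) := Real.sq_sqrt hN
    rw [dualForm] at hs2
    -- The equality case: minus the dual vector of `l`, scaled to the boundary. If `s = 0`, division
    -- by zero returns the center, which serves as well.
    refine ⟨!₂[-((c * l 0 - b / 2 * l 1) / s), -((a * l 1 - b / 2 * l 0) / s)], ?_, ?_⟩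
    · rcases eq_or_ne s 0 with h0 | h0
      · simp [ellipse, h0]
      · change (_ : ℝ) ≤ 1
        refine le_of_eq ?_
        simp only [Matrix.cons_val_zero, Matrix.cons_val_one, Matrix.cons_val_fin_one]
        field_simp
        rw [hs2]
        linear_combination (c * l 0 ^ 2 - b * (l 0 * l 1) + a * l 1 ^ 2) * hdisc
    · rcases eq_or_ne s 0 with h0 | h0
      · simp [inner_plane, h0]
      · simp only [inner_plane, Matrix.cons_val_zero, Matrix.cons_val_one,
          Matrix.cons_val_fin_one]
        field_simp
        linear_combination 2 * hs2

theorem monomialAt_ellipse {a b c : ℝ} (ha : 0 < a) (hdisc : 4 * a * c - b ^ 2 = 4)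
    (x y : ℝ) (p : Plane) : monomialAt (ellipse a b c) !₂[x, y] p =
      ((√(dualForm a b c x y) + (x * p 0 + y * p 1) : ℝ) : EReal) := by
  rw [monomialAt, coeff_ellipse ha hdisc, inner_plane, EReal.coe_add]
  simp

/-- The equation for the root gives `b = -2 a Re z` and `c = a |z|²`. -/
theorem mem_domainU_iff {a b c : ℝ} (ha : 0 < a) {z : ℍ}
    (hz : (a : ℂ) * (z : ℂ) ^ 2 + (b : ℂ) * (z : ℂ) + (c : ℂ) = 0) :
    z ∈ domainU ↔ |b| < a ∧ a < c := by
  have hre := congrArg Complex.re hz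
  have him := congrArg Complex.im hz
  simp [sq] at hre him
  have hb : b = -(2 * a * z.re) := by
    have h : z.im * (b + 2 * a * z.re) = 0 := by linear_combination him
    have := (mul_eq_zero.1 h).resolve_left z.im_ne_zero
    linarith
  have hc : c = a * (z.re ^ 2 + z.im ^ 2) := by
    subst hb
    linear_combination hre
  have h1 : |b| = 2 * a * |z.re| := by
    rw [hb, abs_neg, abs_mul, abs_of_pos (by positivity : 0 < 2 * a)]
  rw [domainU, Set.mem_ofPred_eq, ← Complex.one_lt_normSq_iff, Complex.normSq_apply, coe_re, coe_im,
    ← sq, ← sq, h1, hc]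
  refine and_congr ?_ ?_
  · constructor <;> intro h <;> nlinarith
  · constructor <;> intro h <;> nlinarith

/-- On the segment `|p 0| ≤ √c - √a`, `p 1 = 0`, the linear part is at least `-|m| (√c - √a)`, so
this bound keeps the monomial strictly above `√a` along the whole segment. -/
theorem lt_sqrt_dualForm {a b c : ℝ} (ha : 0 < a) (hba : |b| < a) (hac : a < c) {m n : ℤ}
    (h0 : m ≠ 0 ∨ n ≠ 0) (h1 : ¬(|m| = 1 ∧ n = 0)) (h2 : ¬(m = 0 ∧ |n| = 1)) :
    √a + |(m : ℝ)| * (√c - √a) < √(dualForm a b c m n) := by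
  have hα : 0 < √a := Real.sqrt_pos.2 ha
  have hαγ : √a < √c := Real.sqrt_lt_sqrt ha.le hac
  refine Real.lt_sqrt_of_sq_lt ?_
  have hX : |(m : ℝ)| = ((|m| : ℤ) : ℝ) := by push_cast; rfl
  have hY : |(n : ℝ)| = ((|n| : ℤ) : ℝ) := by push_cast; rfl
  have hcross : b * ((m : ℝ) * n) ≤ |b| * (|(m : ℝ)| * |(n : ℝ)|) := by
    rw [← abs_mul, ← abs_mul]
    exact le_abs_self _
  have hN : c * |(m : ℝ)| ^ 2 - |b| * (|(m : ℝ)| * |(n : ℝ)|) + a * |(n : ℝ)| ^ 2 ≤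
      dualForm a b c m n := by
    rw [dualForm, sq_abs, sq_abs]
    linarith
  refine lt_of_lt_of_le ?_ hN
  rw [← abs_ne_zero, ← abs_ne_zero (a := n)] at h0
  rw [← abs_eq_zero (a := n)] at h1
  rw [← abs_eq_zero (a := m)] at h2
  rw [hX, hY]
  have hm := abs_nonneg m
  have hn := abs_nonneg n
  generalize |m| = X at *
  generalize |n| = Y at *
  have hb := abs_nonneg b
  generalize |b| = β at *
  have ea : √a ^ 2 = a := Real.sq_sqrt ha.le
  have ec : √c ^ 2 = c := Real.sq_sqrt (ha.trans hac).le
  generalize √a = α at *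
  generalize √c = γ at *
  subst ea ec
  rcases (by omega : X = 0 ∧ 2 ≤ Y ∨ X = 1 ∧ 1 ≤ Y ∨ 2 ≤ X) with ⟨rfl, hY2⟩ | ⟨rfl, hY1⟩ | hX2
  · have hY2' : (2 : ℝ) ≤ Y := by exact_mod_cast hY2
    push_cast
    nlinarith [mul_le_mul_of_nonneg_left hY2' ha.le, mul_nonneg ha.le (sub_nonneg.2 hY2'),
      mul_nonneg ha.le (sq_nonneg ((Y : ℝ) - 2))]
  · have hY1' : (1 : ℝ) ≤ Y := by exact_mod_cast hY1
    push_cast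
    nlinarith [mul_pos hα hα, mul_nonneg ha.le (sub_nonneg.2 hY1')]
  -- After replacing `β` by `α²` and completing the square in `Y`, the difference of the two sides
  -- is the sum of the terms in `e2`, `e3` and `e4`.
  · have hX2' : (2 : ℝ) ≤ X := by exact_mod_cast hX2
    have hY0 : (0 : ℝ) ≤ Y := by exact_mod_cast hn
    generalize (X : ℝ) = X at *
    generalize (Y : ℝ) = Y at *
    have e1 : β * (X * Y) ≤ α ^ 2 * (X * Y) := by gcongr
    have e2 : 0 ≤ α ^ 2 * (Y - X / 2) ^ 2 := by positivity
    have e3 : 0 < 2 * X * (X - 1) * (α * (γ - α)) :=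
      mul_pos (mul_pos (by linarith) (by linarith)) (mul_pos hα (by linarith))
    have e4 : 0 < α ^ 2 * (3 / 4 * X ^ 2 - 1) := mul_pos ha (by nlinarith)
    nlinarith

theorem dualForm_zero_one (a b c : ℝ) : dualForm a b c 0 1 = a := by simp [dualForm]

theorem dualForm_zero_neg_one (a b c : ℝ) : dualForm a b c 0 (-1) = a := by simp [dualForm]

theorem dualForm_horizontal (a b c : ℝ) {m n : ℤ} (h : |m| = 1 ∧ n = 0) :
    dualForm a b c m n = c := by
  have hm2 : (m : ℝ) ^ 2 = 1 := by exact_mod_cast (sq_abs m).symm.trans (by rw [h.1, one_pow])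
  simp [dualForm, h.2, hm2]

theorem dualForm_vertical (a b c : ℝ) {m n : ℤ} (h : m = 0 ∧ |n| = 1) :
    dualForm a b c m n = a := by
  have hn2 : (n : ℝ) ^ 2 = 1 := by exact_mod_cast (sq_abs n).symm.trans (by rw [h.2, one_pow])
  simp [dualForm, h.1, hn2]

theorem mem_vertical_iff (l : Plane) : l ∈ ({!₂[(0 : ℝ), 1], !₂[(0 : ℝ), -1]} : Set Plane) ↔
    ∃ m n : ℤ, l = !₂[(m : ℝ), (n : ℝ)] ∧ (m = 0 ∧ |n| = 1) := by
  constructor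
  · rintro (rfl | rfl)
    · exact ⟨0, 1, by simp, by simp⟩
    · exact ⟨0, -1, by simp, by simp⟩
  · rintro ⟨m, n, rfl, rfl, hn⟩
    rcases (abs_eq zero_le_one).1 hn with rfl | rfl <;> simp

theorem mem_axes_iff (l : Plane) :
    l ∈ ({!₂[(1 : ℝ), 0], !₂[(-1 : ℝ), 0], !₂[(0 : ℝ), 1], !₂[(0 : ℝ), -1]} : Set Plane) ↔
      ∃ m n : ℤ, l = !₂[(m : ℝ), (n : ℝ)] ∧ (|m| = 1 ∧ n = 0 ∨ m = 0 ∧ |n| = 1) := by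
  constructor
  · rintro (rfl | rfl | h)
    · exact ⟨1, 0, by simp, by simp⟩
    · exact ⟨-1, 0, by simp, by simp⟩
    · obtain ⟨m, n, h, h'⟩ := (mem_vertical_iff l).1 h
      exact ⟨m, n, h, Or.inr h'⟩
  · rintro ⟨m, n, rfl, ⟨hm, rfl⟩ | h⟩
    · rcases (abs_eq zero_le_one).1 hm with rfl | rfl <;> simp
    · exact Or.inr (Or.inr ((mem_vertical_iff _).2 ⟨m, n, rfl, h⟩))

theorem mk_mem_vertical_iff (m n : ℤ) :
    !₂[(m : ℝ), (n : ℝ)] ∈ ({!₂[(0 : ℝ), 1], !₂[(0 : ℝ), -1]} : Set Plane) ↔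
      m = 0 ∧ |n| = 1 := by
  rw [mem_vertical_iff]
  refine ⟨?_, fun h => ⟨m, n, rfl, h⟩⟩
  rintro ⟨m', n', h, h'⟩
  rw [eq_mk_iff] at h
  simp only [Matrix.cons_val_zero, Matrix.cons_val_one, Matrix.cons_val_fin_one, Int.cast_inj] at h
  rwa [h.1, h.2]

theorem mk_mem_axes_iff (m n : ℤ) : !₂[(m : ℝ), (n : ℝ)] ∈
    ({!₂[(1 : ℝ), 0], !₂[(-1 : ℝ), 0], !₂[(0 : ℝ), 1], !₂[(0 : ℝ), -1]} : Set Plane) ↔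
      |m| = 1 ∧ n = 0 ∨ m = 0 ∧ |n| = 1 := by
  rw [mem_axes_iff]
  refine ⟨?_, fun h => ⟨m, n, rfl, h⟩⟩
  rintro ⟨m', n', h, h'⟩
  rw [eq_mk_iff] at h
  simp only [Matrix.cons_val_zero, Matrix.cons_val_one, Matrix.cons_val_fin_one, Int.cast_inj] at h
  rwa [h.1, h.2]

theorem tropDist_stdLattice_le {a b c : ℝ} (ha : 0 < a) (hdisc : 4 * a * c - b ^ 2 = 4) {m n : ℤ}
    (h : m ≠ 0 ∨ n ≠ 0) (p : Plane) : tropDist stdLattice (ellipse a b c) p ≤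
      ((√(dualForm a b c m n) + (m * p 0 + n * p 1) : ℝ) : EReal) := by
  rw [← monomialAt_ellipse ha hdisc]
  exact tropDist_le (mk_mem_stdLattice m n) ((mk_ne_zero_iff m n).2 h) _ p

theorem tropDist_stdLattice_le_sqrt {a b c : ℝ} (ha : 0 < a) (hdisc : 4 * a * c - b ^ 2 = 4)
    (p : Plane) : tropDist stdLattice (ellipse a b c) p ≤ ((√a - |p 1| : ℝ) : EReal) := by
  rcases abs_choice (p 1) with h | h
  · have h1 := tropDist_stdLattice_le ha hdisc (m := 0) (n := -1) (by simp) p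
    push_cast at h1
    rw [dualForm_zero_neg_one] at h1
    rwa [h, show √a - p 1 = √a + (0 * p 0 + -1 * p 1) by ring]
  · have h1 := tropDist_stdLattice_le ha hdisc (m := 0) (n := 1) (by simp) p
    push_cast at h1
    rw [dualForm_zero_one] at h1
    rwa [h, show √a - -p 1 = √a + (0 * p 0 + 1 * p 1) by ring]

theorem zero_mem_ellipse (a b c : ℝ) : (0 : Plane) ∈ ellipse a b c := by
  simp [ellipse]

theorem mk_mem_minimizers_iff {a b c : ℝ} (ha : 0 < a) (hdisc : 4 * a * c - b ^ 2 = 4) {m n : ℤ}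
    (h : m ≠ 0 ∨ n ≠ 0) {p : Plane} {r : ℝ}
    (hr : tropDist stdLattice (ellipse a b c) p = (r : EReal)) :
    !₂[(m : ℝ), (n : ℝ)] ∈ minimizers stdLattice (ellipse a b c) p ↔
      √(dualForm a b c m n) + (m * p 0 + n * p 1) = r := by
  rw [← EReal.coe_eq_coe_iff, ← hr, ← monomialAt_ellipse ha hdisc]
  exact ⟨fun hl => hl.2.2, fun hl => ⟨mk_mem_stdLattice m n, (mk_ne_zero_iff m n).2 h, hl⟩⟩

/-- On a segment of the horizontal axis the tropical distance function takes the value `√a`. -/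
theorem tropDist_stdLattice_eq {a b c : ℝ} (ha : 0 < a) (hdisc : 4 * a * c - b ^ 2 = 4)
    (hba : |b| < a) (hac : a < c) {p : Plane} (h0 : |p 0| ≤ √c - √a) (h1 : p 1 = 0) :
    tropDist stdLattice (ellipse a b c) p = ((√a : ℝ) : EReal) := by
  refine le_antisymm ?_ (le_tropDist fun l hl hl0 => ?_)
  · simpa [h1] using tropDist_stdLattice_le_sqrt ha hdisc p
  · obtain ⟨m, n, rfl⟩ := exists_eq_mk_of_mem_stdLattice hl
    rw [mk_ne_zero_iff] at hl0
    rw [monomialAt_ellipse ha hdisc, EReal.coe_le_coe_iff, h1, mul_zero, add_zero]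
    have hmp : -(|(m : ℝ)| * (√c - √a)) ≤ m * p 0 := by
      refine neg_le_of_abs_le ?_
      rw [abs_mul]
      gcongr
    have hle : √a + |(m : ℝ)| * (√c - √a) ≤ √(dualForm a b c m n) := by
      by_cases c1 : |m| = 1 ∧ n = 0
      · have hm : |(m : ℝ)| = 1 := by exact_mod_cast c1.1
        rw [dualForm_horizontal a b c c1, hm]
        linarith
      by_cases c2 : m = 0 ∧ |n| = 1
      · rw [dualForm_vertical a b c c2, c2.1]
        simp
      exact (lt_sqrt_dualForm ha hba hac hl0 c1 c2).le
    linarith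

/-- It suffices that `√a (√c - √a) ≤ 1`, which follows from `a c = 1 + b²/4 ≤ (1 + a)²`. -/
theorem mem_ellipse_of_abs_le {a b c : ℝ} (ha : 0 < a) (hdisc : 4 * a * c - b ^ 2 = 4)
    (hba : |b| < a) {p : Plane} (h0 : |p 0| ≤ √c - √a) (h1 : p 1 = 0) : p ∈ ellipse a b c := by
  change a * p 0 ^ 2 + b * (p 0 * p 1) + c * p 1 ^ 2 ≤ 1
  have hc : 0 ≤ c := by nlinarith [sq_nonneg b]
  have ea := Real.sq_sqrt ha.le
  have ec := Real.sq_sqrt hc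
  have hb : b ^ 2 < a ^ 2 := by
    rw [← sq_abs b]
    gcongr
  have hprod : √a * √c ≤ 1 + a := by
    rw [← Real.sqrt_mul ha.le]
    refine Real.sqrt_le_iff.2 ⟨by linarith, by nlinarith⟩
  have hkey : √a * |p 0| ≤ 1 := by
    calc √a * |p 0| ≤ √a * (√c - √a) := by gcongr
      _ = √a * √c - √a ^ 2 := by ring
      _ ≤ 1 := by linarith
  have hsq : (√a * |p 0|) ^ 2 ≤ 1 := pow_le_one₀ (by positivity) hkey
  rw [mul_pow, ea, sq_abs] at hsq
  simpa [h1] using hsq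

theorem isMaxOn_of_eq_sqrt {a b c : ℝ} (ha : 0 < a) (hdisc : 4 * a * c - b ^ 2 = 4) {p : Plane}
    (hp : tropDist stdLattice (ellipse a b c) p = ((√a : ℝ) : EReal)) :
    IsMaxOn (tropDist stdLattice (ellipse a b c)) (ellipse a b c) p := by
  intro q _
  refine (tropDist_stdLattice_le_sqrt ha hdisc q).trans (le_trans ?_ hp.ge)
  rw [EReal.coe_le_coe_iff]
  linarith [abs_nonneg (q 1)]

theorem minimizers_ellipse_zero {a b c : ℝ} (ha : 0 < a) (hdisc : 4 * a * c - b ^ 2 = 4)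
    (hba : |b| < a) (hac : a < c) :
    minimizers stdLattice (ellipse a b c) 0 = {!₂[(0 : ℝ), 1], !₂[(0 : ℝ), -1]} := by
  have hαγ : √a < √c := Real.sqrt_lt_sqrt ha.le hac
  have h0 := tropDist_stdLattice_eq ha hdisc hba hac (p := 0) (by simpa using hαγ.le) rfl
  ext l
  constructor
  · intro hl
    obtain ⟨m, n, rfl⟩ := exists_eq_mk_of_mem_stdLattice hl.1
    have hne := (mk_ne_zero_iff m n).1 hl.2.1
    rw [mk_mem_minimizers_iff ha hdisc hne h0] at hl
    simp only [PiLp.zero_apply, mul_zero, add_zero] at hl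
    rw [mk_mem_vertical_iff]
    by_contra c2
    by_cases c1 : |m| = 1 ∧ n = 0
    · rw [dualForm_horizontal a b c c1] at hl
      exact hαγ.ne' hl
    · have h := lt_sqrt_dualForm ha hba hac hne c1 c2
      have := mul_nonneg (abs_nonneg (m : ℝ)) (sub_nonneg.2 hαγ.le)
      linarith
  · intro hl
    obtain ⟨m, n, rfl, h⟩ := (mem_vertical_iff l).1 hl
    have hne : m ≠ 0 ∨ n ≠ 0 := Or.inr (by rintro rfl; simp at h)
    rw [mk_mem_minimizers_iff ha hdisc hne h0, dualForm_vertical a b c h]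
    simp

theorem maxGradients_ellipse {a b c : ℝ} (ha : 0 < a) (hdisc : 4 * a * c - b ^ 2 = 4)
    (hba : |b| < a) (hac : a < c) :
    maxGradients stdLattice (ellipse a b c) =
      {!₂[(1 : ℝ), 0], !₂[(-1 : ℝ), 0], !₂[(0 : ℝ), 1], !₂[(0 : ℝ), -1]} := by
  have hαγ : √a < √c := Real.sqrt_lt_sqrt ha.le hac
  have h0 := tropDist_stdLattice_eq ha hdisc hba hac (p := 0) (by simpa using hαγ.le) rfl
  ext l
  constructor
  · rintro ⟨p, -, hmax, hl⟩
    have hge : ((√a : ℝ) : EReal) ≤ tropDist stdLattice (ellipse a b c) p :=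
      h0.ge.trans (hmax (zero_mem_ellipse a b c))
    have hp1 : p 1 = 0 := by
      have h := hge.trans (tropDist_stdLattice_le_sqrt ha hdisc p)
      rw [EReal.coe_le_coe_iff] at h
      exact abs_nonpos_iff.1 (by linarith)
    have hp0 : |p 0| ≤ √c - √a := by
      have h1 := hge.trans (tropDist_stdLattice_le ha hdisc (m := 1) (n := 0) (by simp) p)
      have h2 := hge.trans (tropDist_stdLattice_le ha hdisc (m := -1) (n := 0) (by simp) p)
      rw [EReal.coe_le_coe_iff, dualForm_horizontal a b c (by simp)] at h1 h2
      push_cast at h1 h2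
      rw [abs_le]
      constructor <;> linarith
    obtain ⟨m, n, rfl⟩ := exists_eq_mk_of_mem_stdLattice hl.1
    have hne := (mk_ne_zero_iff m n).1 hl.2.1
    rw [mk_mem_minimizers_iff ha hdisc hne
      (tropDist_stdLattice_eq ha hdisc hba hac hp0 hp1), hp1] at hl
    rw [mk_mem_axes_iff]
    by_contra hc
    rw [not_or] at hc
    have h := lt_sqrt_dualForm ha hba hac hne hc.1 hc.2
    have h' : -(|(m : ℝ)| * (√c - √a)) ≤ m * p 0 := by
      refine neg_le_of_abs_le ?_
      rw [abs_mul]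
      gcongr
    linarith
  · intro hl
    obtain ⟨m, n, rfl, h⟩ := (mem_axes_iff l).1 hl
    have hne : m ≠ 0 ∨ n ≠ 0 := by
      rcases h with h | h
      · exact Or.inl (by rintro rfl; simp at h)
      · exact Or.inr (by rintro rfl; simp at h)
    -- For `(±1, 0)` this is the end of the segment where that monomial drops to `√a`; for `(0, ±1)`
    -- it is the center.
    set p : Plane := !₂[-(m * (√c - √a)), 0] with hp
    have hm : |(m : ℝ)| ≤ 1 := by
      rcases h with h | h
      · exact_mod_cast h.1.le
      · simp [h.1]
    have hp0 : |p 0| ≤ √c - √a := by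
      simp only [hp, Matrix.cons_val_zero, abs_neg, abs_mul]
      rw [abs_of_nonneg (sub_nonneg.2 hαγ.le)]
      exact mul_le_of_le_one_left (sub_nonneg.2 hαγ.le) hm
    have hp1 : p 1 = 0 := by simp [hp]
    have hval := tropDist_stdLattice_eq ha hdisc hba hac hp0 hp1
    refine ⟨p, mem_ellipse_of_abs_le ha hdisc hba hp0 hp1, isMaxOn_of_eq_sqrt ha hdisc hval, ?_⟩
    rw [mk_mem_minimizers_iff ha hdisc hne hval, hp1]
    simp only [hp, Matrix.cons_val_zero]
    rcases h with h | h
    · have hm2 : (m : ℝ) ^ 2 = 1 := by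
        exact_mod_cast (sq_abs m).symm.trans (by rw [h.1, one_pow])
      rw [dualForm_horizontal a b c h]
      linear_combination (√a - √c) * hm2
    · rw [dualForm_vertical a b c h, h.1]
      simp

theorem reduced_of_gradients {a b c : ℝ} (ha : 0 < a) (hc : 0 < c)
    (hdisc : 4 * a * c - b ^ 2 = 4)
    (hmax : maxGradients stdLattice (ellipse a b c) =
      {!₂[(1 : ℝ), 0], !₂[(-1 : ℝ), 0], !₂[(0 : ℝ), 1], !₂[(0 : ℝ), -1]})
    (hmin : minimizers stdLattice (ellipse a b c) 0 = {!₂[(0 : ℝ), 1], !₂[(0 : ℝ), -1]}) :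
    |b| < a ∧ a < c := by
  have h0 : tropDist stdLattice (ellipse a b c) 0 = ((√a : ℝ) : EReal) := by
    have h : !₂[((0 : ℤ) : ℝ), ((1 : ℤ) : ℝ)] ∈ minimizers stdLattice (ellipse a b c) 0 := by
      rw [hmin, mk_mem_vertical_iff]
      simp
    rw [← h.2.2, monomialAt_ellipse ha hdisc, dualForm_vertical a b c (by simp)]
    simp
  have hac : a < c := by
    have h : !₂[((1 : ℤ) : ℝ), ((0 : ℤ) : ℝ)] ∉ minimizers stdLattice (ellipse a b c) 0 := by
      rw [hmin, mk_mem_vertical_iff]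
      simp
    have h1 := tropDist_stdLattice_le ha hdisc (m := 1) (n := 0) (by simp) 0
    rw [mk_mem_minimizers_iff ha hdisc (by simp) h0] at h
    rw [h0, EReal.coe_le_coe_iff] at h1
    rw [dualForm_horizontal a b c (by simp)] at h h1
    simp only [PiLp.zero_apply, mul_zero, add_zero] at h h1
    exact lt_of_le_of_ne ((Real.sqrt_le_sqrt_iff hc.le).1 h1) fun h2 => h (by rw [h2])
  refine ⟨?_, hac⟩
  have hmem : !₂[((1 : ℤ) : ℝ), ((0 : ℤ) : ℝ)] ∈ maxGradients stdLattice (ellipse a b c) := by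
    rw [hmax, mk_mem_axes_iff]
    simp
  obtain ⟨p, hp, hpmax, hpmin⟩ := hmem
  have hge : ((√a : ℝ) : EReal) ≤ tropDist stdLattice (ellipse a b c) p :=
    h0.ge.trans (hpmax (zero_mem_ellipse a b c))
  have hp1 : p 1 = 0 := by
    have h := hge.trans (tropDist_stdLattice_le_sqrt ha hdisc p)
    rw [EReal.coe_le_coe_iff] at h
    exact abs_nonpos_iff.1 (by linarith)
  have hval : tropDist stdLattice (ellipse a b c) p = ((√a : ℝ) : EReal) := by
    refine le_antisymm ?_ hge
    simpa [hp1] using tropDist_stdLattice_le_sqrt ha hdisc p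
  rw [mk_mem_minimizers_iff ha hdisc (by simp) hval, dualForm_horizontal a b c (by simp), hp1]
    at hpmin
  -- At `p`, where `(1, 0)` attains the minimum, `p 1 = 0` gives `(1, n)` the same linear part. As
  -- `(1, n)` is not an allowed gradient, its coefficient is strictly larger: `c < c - b n + a`.
  have key : ∀ n : ℤ, |n| = 1 → 0 < a - b * n := by
    intro n hn
    have hnot : !₂[((1 : ℤ) : ℝ), (n : ℝ)] ∉ minimizers stdLattice (ellipse a b c) p := by
      intro h
      have : !₂[((1 : ℤ) : ℝ), (n : ℝ)] ∈ maxGradients stdLattice (ellipse a b c) :=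
        ⟨p, hp, hpmax, h⟩
      rw [hmax, mk_mem_axes_iff] at this
      rcases this with h | h
      · simp [h.2] at hn
      · simp at h
    have hle := tropDist_stdLattice_le ha hdisc (m := 1) (n := n) (by simp) p
    rw [mk_mem_minimizers_iff ha hdisc (by simp) hval, hp1] at hnot
    rw [hval, EReal.coe_le_coe_iff, hp1] at hle
    have hlt := lt_of_le_of_ne hle (Ne.symm hnot)
    have hsqrt : √c < √(dualForm a b c (1 : ℤ) n) := by linarith
    have hlt' := (Real.sqrt_lt_sqrt_iff hc.le).1 hsqrt
    have hn2 : (n : ℝ) ^ 2 = 1 := by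
      exact_mod_cast (sq_abs n).symm.trans (by rw [hn, one_pow])
    rw [dualForm, hn2] at hlt'
    push_cast at hlt'
    linarith
  have h1 := key 1 (by simp)
  have h2 := key (-1) (by simp)
  push_cast at h1 h2
  rw [abs_lt]
  constructor <;> linarith

end EquiAffine

theorem mainTheorem5 :
    -- the stratum of ellipses parametrized by `U`, and the value at their center
    (∀ a b c : ℝ, 0 < a → 0 < c → 4 * a * c - b ^ 2 = 4 →
      ∀ z : ℍ, (a : ℂ) * (z : ℂ) ^ 2 + (b : ℂ) * (z : ℂ) + (c : ℂ) = 0 →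
        (z ∈ domainU ↔
          maxGradients stdLattice (ellipse a b c) =
              {!₂[(1 : ℝ), 0], !₂[(-1 : ℝ), 0], !₂[(0 : ℝ), 1], !₂[(0 : ℝ), -1]} ∧
            minimizers stdLattice (ellipse a b c) 0 = {!₂[(0 : ℝ), 1], !₂[(0 : ℝ), -1]}) ∧
        (z ∈ domainU →
          tropDist stdLattice (ellipse a b c) 0 = ((Real.sqrt a : ℝ) : EReal))) ∧
    -- reduction to an integral over `U` against the hyperbolic measure `dx dy / y²`
    equiAffineDist 1 disk 0 =
      (volume domainU)⁻¹ * ∫⁻ z in domainU, ENNReal.ofReal (z.im ^ (-(1 / 2) : ℝ)) ∧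
    -- the value
    equiAffineDist 1 disk 0 =
      ENNReal.ofReal (4 / Real.pi * (∫ t in (0 : ℝ)..(Real.pi / 6), 1 / Real.sqrt (Real.cos t))) ∧
    0.682 < 4 / Real.pi * (∫ t in (0 : ℝ)..(Real.pi / 6), 1 / Real.sqrt (Real.cos t)) ∧
    4 / Real.pi * (∫ t in (0 : ℝ)..(Real.pi / 6), 1 / Real.sqrt (Real.cos t)) < 0.683 := by
  have hvalue := equiAffineDist_one_disk_zero.trans setLIntegral_domainU_half
  refine ⟨fun a b c ha hc hdisc z hz => ⟨?_, fun hzU => ?_⟩, equiAffineDist_one_disk_zero, hvalue,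
    lt_four_div_pi_mul_integral, four_div_pi_mul_integral_lt⟩
  · rw [mem_domainU_iff ha hz]
    exact ⟨fun h => ⟨maxGradients_ellipse ha hdisc h.1 h.2,
      minimizers_ellipse_zero ha hdisc h.1 h.2⟩,
      fun h => reduced_of_gradients ha hc hdisc h.1 h.2⟩
  · obtain ⟨hba, hac⟩ := (mem_domainU_iff ha hz).1 hzU
    exact tropDist_stdLattice_eq ha hdisc hba hac
      (by simpa using Real.sqrt_le_sqrt hac.le) rfl
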